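/- Let $m,k,d,n\in\mathbb{N}$ and $p\in[2,3)$. For $T>0$, a path $X$ on $[0,T]$ and a two-parameter function $A$ on $\{0\le s\le t\le T\}$, write $X_{s,t}=X_t-X_s$ and $$\|A\|_{q}=\Big(\sup_{\mathcal P}\sum_{[s,t]\in\mathcal P}|A_{s,t}|^{q}\Big)^{1/q},$$ the supremum being over all partitions $\mathcal P$ of $[0,T]$, and let $\|X\|_q$ be this quantity for $A_{s,t}=X_{s,t}$. Let $\mathcal C^{q\text{-var}}$ be the space of continuous paths with $\|X\|_q<\infty$. A $\frac1p$-Hölder rough path is a pair $\boldsymbol\zeta=(\zeta,\zeta^{(2)})$ with $\zeta\colon[0,T]\to\mathbb{R}^d$ and $\zeta^{(2)}_{s,t}\in\mathbb{R}^d\otimes\mathbb{R}^d$ for $0\le s\le t\le T$, such that $\zeta^{(2)}_{s,t}=\zeta^{(2)}_{s,r}+\zeta^{(2)}_{r,t}+\zeta_{s,r}\otimes\zeta_{r,t}$ for all $s\le r\le t$ and $$|||\boldsymbol\zeta|||_{\frac1p\text{-Höl}}:=\sup_{s<t}\frac{|\zeta_{s,t}|}{|t-s|^{1/p}}+\sup_{s<t}\frac{|\zeta^{(2)}_{s,t}|}{|t-s|^{2/p}}<\infty.$$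 A controlled path (with respect to $\zeta$) is a pair $(X,X')$ of paths in $\mathcal C^{p\text{-var}}$, with $X'_s$ linear from $\mathbb{R}^d$ to the space in which $X$ takes its values, whose remainder $R^X_{s,t}:=X_{s,t}-X'_s\zeta_{s,t}$ satisfies $\|R^X\|_{p/2}<\infty$. For a controlled path $(Y,Y')$ with values in $\mathcal L(\mathbb{R}^d;\mathbb{R}^m)$, the rough integral is $\int_0^tY_r\,\mathrm d\boldsymbol\zeta_r=\lim_{|\mathcal P|\to0}\sum_{[u,v]\in\mathcal P}\big(Y_u\zeta_{u,v}+Y'_u\zeta^{(2)}_{u,v}\big)$ over partitions of $[0,t]$, where $\mathcal L(\mathbb{R}^d;\mathcal L(\mathbb{R}^d;\mathbb{R}^m))\simeq\mathcal L(\mathbb{R}^d\otimes\mathbb{R}^d;\mathbb{R}^m)$. Let $b\colon\mathbb{R}^m\times\mathbb{R}^k\to\mathbb{R}^m$ be bounded and Lipschitz, and let $\lambda\colon\mathbb{R}^m\times\mathbb{R}^k\to\mathcal L(\mathbb{R}^d;\mathbb{R}^m)$ and $\psi\colon\mathbb{R}^m\times\mathbb{R}^k\to\mathcal L(\mathbb{R}^d;\mathbb{R}^n)$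 be of class $C^2_b$ (twice continuously differentiable, bounded together with all derivatives up to order two). Let $T,L>0$, let $\boldsymbol\zeta$ be a $\frac1p$-Hölder rough path with $|||\boldsymbol\zeta|||_{\frac1p\text{-Höl}}\le L$, let $\gamma\in\mathcal C^{\frac p2\text{-var}}([0,T];\mathbb{R}^k)$ and $x\in\mathbb{R}^m$. Suppose that $X$, with $X'=\lambda(X,\gamma)$, solves $$\mathrm dX_s=b(X_s,\gamma_s)\,\mathrm ds+\lambda(X_s,\gamma_s)\,\mathrm d\boldsymbol\zeta_s,\qquad X_0=x,$$ that is, $(X,\lambda(X,\gamma))$ is a controlled path and $X_t=x+\int_0^tb(X_s,\gamma_s)\,\mathrm ds+\int_0^t\lambda(X_s,\gamma_s)\,\mathrm d\boldsymbol\zeta_s$ for all $t\in[0,T]$. Here $f(X,\gamma)$, for $f=\lambda$ or $f=\psi$, carries the Gubinelli derivative $f(X,\gamma)'=D_xf(X,\gamma)X'$, and $R^{f(X,\gamma)}$ denotes the corresponding remainder. Then (i) $\|\psi(X,\gamma)'\|_p\le C_{\lambda,\psi,p}\big(\|X\|_p+\|\gamma\|_{\frac p2}\big)$; (ii) $\|R^{\psi(X,\gamma)}\|_{\frac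 p2}\le C_{\psi,p}\big(\|X\|_p^2+\|R^X\|_{\frac p2}+\|\gamma\|_{\frac p2}\big)$; (iii) $\|X\|_p\le C_{b,\lambda,p,T,L}\big(1+\|\gamma\|_{\frac p2}^{1+p}\big)$; (iv) $\|R^X\|_{\frac p2}\le C_{b,\lambda,p,T,L}\big(1+\|\gamma\|_{\frac p2}^{2+p}\big)$, where in each case the finite constant $C$ depends only on the indicated data (and on the dimensions that these fix). -/

import Mathlib

open scoped ENNReal NNReal TensorProduct

noncomputable section

namespace RoughControl

/-- The Euclidean space `ℝⁿ`. -/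
abbrev Vec (n : ℕ) : Type := EuclideanSpace ℝ (Fin n)

/-- `ℒ(ℝᵈ; ℝⁿ)` with the operator norm. -/
abbrev Lin (d n : ℕ) : Type := Vec d →L[ℝ] Vec n

/-- `Lip_b`: bounded Lipschitz functions `ℝᵐ × ℝᵏ → ℝᵐ`. -/
structure IsLipB {m k : ℕ} (b : Vec m × Vec k → Vec m) : Prop where
  lipschitz : ∃ K : ℝ≥0, LipschitzWith K b
  bounded : ∃ M : ℝ, ∀ z, ‖b z‖ ≤ M

/-- `C^r_b`: the function is `r` times continuously differentiable, and it and all its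
derivatives up to order `r` are uniformly bounded. -/
structure IsCb (r : ℕ) {m k d n : ℕ} (f : Vec m × Vec k → Lin d n) : Prop where
  contDiff : ContDiff ℝ r f
  bounded : ∃ M : ℝ, ∀ i ≤ r, ∀ z, ‖iteratedFDeriv ℝ i f z‖ ≤ M

/-- A partition `s = u₀ < u₁ < ⋯ < u_N = t` of the interval `[s, t]`
(the values `u i` with `i > N` play no role). -/
structure Partition (s t : ℝ) where
  N : ℕ
  u : ℕ → ℝ
  first : u 0 = s
  last : u N = t
  lt_succ : ∀ i < N, u i < u (i + 1)

/-- The mesh size of a partition is at most `δ`. -/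
def Partition.MeshLE {s t : ℝ} (P : Partition s t) (δ : ℝ) : Prop :=
  ∀ i < P.N, P.u (i + 1) - P.u i ≤ δ

section Norms

variable {E : Type*} [NormedAddCommGroup E]

/-- The increments `X_{s,t} = X_t - X_s` of a path. -/
def incr (X : ℝ → E) (s t : ℝ) : E := X t - X s

/-- The `q`-variation `(sup_P ∑_{[u,v] ∈ P} |A_{u,v}|^q)^{1/q}` over `[0, T]` of a two-parameter
function, with values in `[0, ∞]`. -/
def pVar2 (q T : ℝ) (A : ℝ → ℝ → E) : ℝ≥0∞ :=
  (⨆ P : Partition 0 T, ∑ i ∈ Finset.range P.N, ‖A (P.u i) (P.u (i + 1))‖ₑ ^ q) ^ (1 / q)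

/-- The `q`-variation over `[0, T]` of a path. -/
def pVar (q T : ℝ) (X : ℝ → E) : ℝ≥0∞ := pVar2 q T (incr X)

/-- The `α`-Hölder norm `sup_{0 ≤ s < t ≤ T} |A_{s,t}| / |t - s|^α` of a two-parameter function,
with values in `[0, ∞]`. -/
def holder2 (α T : ℝ) (A : ℝ → ℝ → E) : ℝ≥0∞ :=
  ⨆ (s : ℝ) (t : ℝ) (_ : 0 ≤ s ∧ s < t ∧ t ≤ T), ‖A s t‖ₑ / ENNReal.ofReal ((t - s) ^ α)

/-- The space `C^{q-var}([0, T])` of continuous paths of finite `q`-variation. -/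
structure IsVarPath (q T : ℝ) (X : ℝ → E) : Prop where
  continuousOn : ContinuousOn X (Set.Icc 0 T)
  finite : pVar q T X < ∞

end Norms

/-- An `ℝᵈ`-valued `1/p`-Hölder rough path `(ζ, ζ⁽²⁾)` over `[0, T]`. Here `ℝᵈ ⊗ ℝᵈ` carries the
Hilbert space (Frobenius) norm. Values at times outside `[0, T]` play no role. -/
structure RoughPath (d : ℕ) (p T : ℝ) where
  path : ℝ → Vec d
  enh : ℝ → ℝ → Vec d ⊗[ℝ] Vec d
  chen : ∀ s r t : ℝ, 0 ≤ s → s ≤ r → r ≤ t → t ≤ T →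
    enh s t = enh s r + enh r t + incr path s r ⊗ₜ[ℝ] incr path r t
  path_finite : holder2 (1 / p) T (incr path) < ∞
  enh_finite : holder2 (2 / p) T enh < ∞

/-- `‖ζ‖_{1/p-Höl} + ‖ζ⁽²⁾‖_{2/p-Höl}`. -/
def RoughPath.holderNorm {d : ℕ} {p T : ℝ} (Z : RoughPath d p T) : ℝ≥0∞ :=
  holder2 (1 / p) T (incr Z.path) + holder2 (2 / p) T Z.enh

section Controlled

variable {F : Type*} [NormedAddCommGroup F] [NormedSpace ℝ F] {d : ℕ}

/-- The remainder `R^X_{s,t} = X_{s,t} - X'_s ζ_{s,t}`. -/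
def remainder (ζ : ℝ → Vec d) (X : ℝ → F) (X' : ℝ → Vec d →L[ℝ] F) (s t : ℝ) : F :=
  incr X s t - X' s (incr ζ s t)

/-- `(X, X')` belongs to the space `𝒟^p_ζ` of paths controlled by `ζ` in the sense of Gubinelli. -/
structure IsControlled (p T : ℝ) (ζ : ℝ → Vec d) (X : ℝ → F) (X' : ℝ → Vec d →L[ℝ] F) :
    Prop where
  path : IsVarPath p T X
  deriv : IsVarPath p T X'
  remainder_finite : pVar2 (p / 2) T (remainder ζ X X') < ∞

/-- The action of `A ∈ ℒ(ℝᵈ; ℒ(ℝᵈ; F)) ≃ ℒ(ℝᵈ ⊗ ℝᵈ; F)` on `ℝᵈ ⊗ ℝᵈ`, for which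
`v ⊗ w ↦ A v w`. -/
def tensorApply (A : Vec d →L[ℝ] Vec d →L[ℝ] F) (z : Vec d ⊗[ℝ] Vec d) : F :=
  TensorProduct.lift A.toLinearMap₁₂ z

/-- `I = ∫_s^t Y dζ` as a rough integral: `I` is the limit, as the mesh size of the partition of
`[s, t]` tends to zero, of the compensated Riemann sums `∑ (Y_u ζ_{u,v} + Y'_u ζ⁽²⁾_{u,v})`. -/
def HasRoughIntegral {p T : ℝ} (Z : RoughPath d p T) (Y : ℝ → Vec d →L[ℝ] F)
    (Y' : ℝ → Vec d →L[ℝ] Vec d →L[ℝ] F) (s t : ℝ) (I : F) : Prop :=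
  ∀ ε > 0, ∃ δ > 0, ∀ P : Partition s t, P.MeshLE δ →
    ‖(∑ i ∈ Finset.range P.N,
        (Y (P.u i) (incr Z.path (P.u i) (P.u (i + 1))) +
          tensorApply (Y' (P.u i)) (Z.enh (P.u i) (P.u (i + 1))))) - I‖ ≤ ε

end Controlled

/-- The path `f(X, γ)`. -/
def comp {m k d n : ℕ} (f : Vec m × Vec k → Lin d n) (X : ℝ → Vec m) (γ : ℝ → Vec k) (s : ℝ) :
    Lin d n :=
  f (X s, γ s)

/-- The Gubinelli derivative `f(X, γ)' = D_x f(X, γ) X'` of `f(X, γ)`, where `D_x` is the Fréchet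
derivative in the first argument. -/
def compDeriv {m k d n : ℕ} (f : Vec m × Vec k → Lin d n) (X : ℝ → Vec m) (γ : ℝ → Vec k)
    (X' : ℝ → Lin d m) (s : ℝ) : Vec d →L[ℝ] Lin d n :=
  (fderiv ℝ (fun x => f (x, γ s)) (X s)).comp (X' s)

/-- `(X, X')` with `X' = lam(X, γ)` solves `dX = b(X, γ) ds + lam(X, γ) dζ`, `X_0 = x`, on
`[0, T]`: it is a controlled path, and
`X_t = x + ∫_0^t b(X_s, γ_s) ds + ∫_0^t lam(X_s, γ_s) dζ_s` for all `t ∈ [0, T]`. -/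
structure IsRDESolution {m k d : ℕ} {p T : ℝ} (b : Vec m × Vec k → Vec m)
    (lam : Vec m × Vec k → Lin d m) (Z : RoughPath d p T) (γ : ℝ → Vec k) (x : Vec m)
    (X : ℝ → Vec m) : Prop where
  controlled : IsControlled p T Z.path X (comp lam X γ)
  equation : ∀ t ∈ Set.Icc 0 T, ∃ I : Vec m,
    HasRoughIntegral Z (comp lam X γ) (compDeriv lam X γ (comp lam X γ)) 0 t I ∧
      X t = x + (∫ s in (0 : ℝ)..t, b (X s, γ s)) + I

end RoughControl

end

/-! Claims (i) and (ii) are pointwise estimates summed over partitions. The product `D_xψ(X,γ)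
λ(X,γ)` is Lipschitz in `(X,γ)`, and a first order Taylor expansion of `ψ` in `x` bounds the
remainder. Minkowski's inequality and the monotonicity of `q`-variation in `q` do the rest
(`pVar_compDeriv_le`, `pVar2_remainder_comp_le`).

For (iii) and (iv) more is proved: both norms grow at most linearly in `‖γ‖_{p/2}`, and the powers
`1+p` and `2+p` enter only through `g ≤ 1 + g^q`. The core is a bound on `R^X`. The defect of
additivity of the germ `λζ + λ'ζ⁽²⁾` is made of `R^{λ(X,γ)} ζ` and an increment of `λ'` applied to
`ζ⁽²⁾` (`germ_sub_sub`). Against a control `w` it has order `w^{3/p}` with `3/p > 1`, so sewing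
(`norm_partition_sum_sub_le`) compares the rough integral with its germ.

The Taylor error in `R^{λ(X,γ)}` is quadratic in `X`, hence apparently in `R^X`, which would force a
step size depending on the solution. `norm_remainder_comp_le_linear` avoids this: where `R^X`
dominates the increment of `ζ`, the Lipschitz bound replaces the quadratic one. The estimate becomes
affine in `R^X` and `γ`, with a factor `h^{1/p}` on an interval of length `h`. A small `h`, fixed by
the data alone, lets `R^X`, finite a priori, be absorbed into the left side
(`IsRDESolution.qnorm_remainder_le`). Finitely many such intervals cover `[0,T]`; gluing them costs
a constant because `λ` is bounded (`qnorm_le_nat_mul`). Finally `X_{s,t} = λ(X_s,γ_s) ζ_{s,t} +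
R^X_{s,t}` gives (iii). -/

namespace RoughControl

/-! ### Partitions of an interval -/

namespace Partition

variable {a b c : ℝ}

theorem mono (P : Partition a b) {i j : ℕ} (hij : i ≤ j) (hj : j ≤ P.N) : P.u i ≤ P.u j := by
  induction j, hij using Nat.le_induction with
  | base => exact le_rfl
  | succ j hij ih => exact (ih (by omega)).trans (P.lt_succ j (by omega)).le

theorem mem_Icc (P : Partition a b) {i : ℕ} (hi : i ≤ P.N) : P.u i ∈ Set.Icc a b :=
  ⟨P.first.symm.le.trans (P.mono (Nat.zero_le i) hi), (P.mono hi le_rfl).trans P.last.le⟩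

/-- The trivial partition of `[a, b]`. -/
def trivial (h : a < b) : Partition a b where
  N := 1
  u i := if i = 0 then a else b
  first := by simp
  last := by simp
  lt_succ := by
    intro i hi
    obtain rfl : i = 0 := by omega
    simpa using h

/-- The empty partition of `[a, a]`. -/
def refl (a : ℝ) : Partition a a where
  N := 0
  u _ := a
  first := rfl
  last := rfl
  lt_succ := by simp

theorem nonempty (h : a ≤ b) : Nonempty (Partition a b) := by
  rcases h.eq_or_lt with rfl | h
  · exact ⟨refl a⟩
  · exact ⟨trivial h⟩

/-- Concatenation of partitions. -/
def concat (P : Partition a b) (Q : Partition b c) : Partition a c where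
  N := P.N + Q.N
  u i := if i ≤ P.N then P.u i else Q.u (i - P.N)
  first := by simp [P.first]
  last := by
    rcases Nat.eq_zero_or_pos Q.N with h | h
    · have := Q.last
      rw [h, Q.first] at this
      simp [h, P.last, this]
    · rw [if_neg (by omega), Nat.add_sub_cancel_left, Q.last]
  lt_succ := by
    intro i hi
    rcases lt_trichotomy i P.N with h | h | h
    · rw [if_pos (by omega), if_pos (by omega)]
      exact P.lt_succ i h
    · rw [if_pos (by omega), if_neg (by omega), show i + 1 - P.N = 0 + 1 by omega, h]
      exact (P.last.trans Q.first.symm).trans_lt (Q.lt_succ 0 (by omega))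
    · rw [if_neg (by omega), if_neg (by omega), show i + 1 - P.N = i - P.N + 1 by omega]
      exact Q.lt_succ _ (by omega)

theorem concat_left (P : Partition a b) (Q : Partition b c) {i : ℕ} (hi : i ≤ P.N) :
    (P.concat Q).u i = P.u i := if_pos hi

theorem concat_right (P : Partition a b) (Q : Partition b c) (i : ℕ) :
    (P.concat Q).u (P.N + i) = Q.u i := by
  rcases Nat.eq_zero_or_pos i with rfl | h
  · simp [concat, P.last, Q.first]
  · simp only [concat]
    rw [if_neg (by omega), Nat.add_sub_cancel_left]

theorem sum_concat {M : Type*} [AddCommMonoid M] (P : Partition a b) (Q : Partition b c)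
    (f : ℝ → ℝ → M) :
    ∑ i ∈ Finset.range (P.concat Q).N, f ((P.concat Q).u i) ((P.concat Q).u (i + 1)) =
      (∑ i ∈ Finset.range P.N, f (P.u i) (P.u (i + 1))) +
        ∑ i ∈ Finset.range Q.N, f (Q.u i) (Q.u (i + 1)) := by
  have hN : (P.concat Q).N = P.N + Q.N := rfl
  rw [hN, Finset.sum_range_add]
  congr 1
  · refine Finset.sum_congr rfl fun i hi => ?_
    have := Finset.mem_range.1 hi
    rw [concat_left P Q (by omega), concat_left P Q (by omega)]
  · refine Finset.sum_congr rfl fun i _ => ?_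
    rw [add_assoc, concat_right, concat_right]

theorem MeshLE.concat {P : Partition a b} {Q : Partition b c} {δ : ℝ} (hP : P.MeshLE δ)
    (hQ : Q.MeshLE δ) : (P.concat Q).MeshLE δ := by
  intro i hi
  rcases lt_or_ge i P.N with h | h
  · rw [concat_left P Q (by omega), concat_left P Q (by omega)]
    exact hP i h
  · obtain ⟨j, rfl⟩ := Nat.exists_eq_add_of_le h
    rw [add_assoc, concat_right, concat_right]
    exact hQ j (Nat.add_lt_add_iff_left.1 hi)

theorem exists_meshLE (h : a ≤ b) {δ : ℝ} (hδ : 0 < δ) : ∃ P : Partition a b, P.MeshLE δ := by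
  rcases h.eq_or_lt with rfl | h
  · exact ⟨refl a, fun i hi => absurd hi (Nat.not_lt_zero i)⟩
  · obtain ⟨n, hn⟩ := exists_nat_gt ((b - a) / δ)
    have hn0 : (0 : ℝ) < n := (div_pos (sub_pos.2 h) hδ).trans hn
    have hs : ∀ i : ℕ, a + ((i + 1 : ℕ) : ℝ) * ((b - a) / n) - (a + i * ((b - a) / n)) =
        (b - a) / n := fun i => by push_cast; ring
    refine ⟨⟨n, fun i => a + i * ((b - a) / n), by simp, by field_simp; ring, fun i _ => ?_⟩,
      fun i _ => ?_⟩
    · have := div_pos (sub_pos.2 h) hn0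
      linarith [hs i]
    · change a + ((i + 1 : ℕ) : ℝ) * ((b - a) / n) - (a + i * ((b - a) / n)) ≤ δ
      rw [hs, div_le_iff₀ hn0]
      rw [div_lt_iff₀ hδ] at hn
      linarith

end Partition

/-! ### Variation norms and superadditive controls -/

/-- The supremum of `∑ f u v` over the partitions of `[a, b]`. -/
noncomputable def supSum (a b : ℝ) (f : ℝ → ℝ → ℝ≥0∞) : ℝ≥0∞ :=
  ⨆ P : Partition a b, ∑ i ∈ Finset.range P.N, f (P.u i) (P.u (i + 1))

/-- The `q`-variation of `f` over `[a, b]`. -/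
noncomputable def qnorm (q a b : ℝ) (f : ℝ → ℝ → ℝ≥0∞) : ℝ≥0∞ :=
  supSum a b (fun s t => f s t ^ q) ^ (1 / q)

section supSum

variable {a b c q : ℝ} {f g : ℝ → ℝ → ℝ≥0∞}

theorem sum_le_supSum (P : Partition a b) (f : ℝ → ℝ → ℝ≥0∞) :
    ∑ i ∈ Finset.range P.N, f (P.u i) (P.u (i + 1)) ≤ supSum a b f :=
  le_iSup (fun P : Partition a b => ∑ i ∈ Finset.range P.N, f (P.u i) (P.u (i + 1))) P

theorem le_supSum (h : a < b) (f : ℝ → ℝ → ℝ≥0∞) : f a b ≤ supSum a b f := by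
  simpa [Partition.trivial] using sum_le_supSum (Partition.trivial h) f

theorem supSum_add_le (hab : a ≤ b) (hbc : b ≤ c) (f : ℝ → ℝ → ℝ≥0∞) :
    supSum a b f + supSum b c f ≤ supSum a c f := by
  have := Partition.nonempty hab
  have := Partition.nonempty hbc
  refine ENNReal.iSup_add_iSup_le fun P Q => ?_
  rw [← Partition.sum_concat P Q f]
  exact sum_le_supSum _ f

theorem supSum_mono_interval {s t : ℝ} (has : a ≤ s) (hst : s ≤ t) (htb : t ≤ b)
    (f : ℝ → ℝ → ℝ≥0∞) : supSum s t f ≤ supSum a b f :=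
  calc supSum s t f ≤ supSum a s f + supSum s t f := le_add_self
    _ ≤ supSum a t f := supSum_add_le has hst f
    _ ≤ supSum a t f + supSum t b f := le_self_add
    _ ≤ supSum a b f := supSum_add_le (has.trans hst) htb f

theorem supSum_mono (h : ∀ s t, a ≤ s → s < t → t ≤ b → f s t ≤ g s t) :
    supSum a b f ≤ supSum a b g := by
  refine iSup_le fun P => (Finset.sum_le_sum fun i hi => ?_).trans (sum_le_supSum P g)
  have hi := Finset.mem_range.1 hi
  exact h _ _ (P.mem_Icc hi.le).1 (P.lt_succ i hi) (P.mem_Icc hi).2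

/-- The sum of a superadditive function along a nondecreasing sequence. -/
theorem sum_le_of_superadditive {u : ℕ → ℝ} {n : ℕ}
    (hu : ∀ i < n, u i ≤ u (i + 1)) (ha : ∀ i ≤ n, u i ∈ Set.Icc a b)
    (hg : ∀ r s t, a ≤ r → r ≤ s → s ≤ t → t ≤ b → g r s + g s t ≤ g r t) :
    u 0 ≤ u n ∧ ∑ i ∈ Finset.range n, g (u i) (u (i + 1)) ≤ g (u 0) (u n) := by
  induction n with
  | zero => simp
  | succ n ih =>
    obtain ⟨h1, h2⟩ := ih (fun i hi => hu i (by omega)) (fun i hi => ha i (by omega))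
    refine ⟨h1.trans (hu n (by omega)), ?_⟩
    rw [Finset.sum_range_succ]
    exact (add_le_add_left h2 _).trans
      (hg _ _ _ (ha 0 (by omega)).1 h1 (hu n (by omega)) (ha _ le_rfl).2)

theorem supSum_le_of_superadditive (hfg : ∀ s t, a ≤ s → s < t → t ≤ b → f s t ≤ g s t)
    (hg : ∀ r s t, a ≤ r → r ≤ s → s ≤ t → t ≤ b → g r s + g s t ≤ g r t) :
    supSum a b f ≤ g a b := by
  refine (supSum_mono hfg).trans (iSup_le fun P => ?_)
  have := (sum_le_of_superadditive (u := P.u) (n := P.N) (fun i hi => (P.lt_succ i hi).le)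
    (fun i hi => P.mem_Icc hi) hg).2
  rwa [P.first, P.last] at this

theorem qnorm_mono (hq : 0 < q) (h : ∀ s t, a ≤ s → s < t → t ≤ b → f s t ≤ g s t) :
    qnorm q a b f ≤ qnorm q a b g :=
  ENNReal.rpow_le_rpow (supSum_mono fun s t h1 h2 h3 =>
    ENNReal.rpow_le_rpow (h s t h1 h2 h3) hq.le) (by positivity)

theorem qnorm_le_iff (hq : 0 < q) {C : ℝ≥0∞} :
    qnorm q a b f ≤ C ↔ ∀ P : Partition a b,
      (∑ i ∈ Finset.range P.N, f (P.u i) (P.u (i + 1)) ^ q) ^ (1 / q) ≤ C := by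
  simp only [qnorm, supSum, one_div, ENNReal.rpow_inv_le_iff hq, iSup_le_iff]

theorem sum_rpow_le_qnorm (hq : 0 < q) (P : Partition a b) (f : ℝ → ℝ → ℝ≥0∞) :
    (∑ i ∈ Finset.range P.N, f (P.u i) (P.u (i + 1)) ^ q) ^ (1 / q) ≤ qnorm q a b f :=
  (qnorm_le_iff hq).1 le_rfl P

theorem qnorm_add_le (hq : 1 ≤ q) (f g : ℝ → ℝ → ℝ≥0∞) :
    qnorm q a b (fun s t => f s t + g s t) ≤ qnorm q a b f + qnorm q a b g := by
  have hq0 : 0 < q := by linarith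
  refine (qnorm_le_iff hq0).2 fun P => (ENNReal.Lp_add_le _ _ _ hq).trans ?_
  exact add_le_add (sum_rpow_le_qnorm hq0 P f) (sum_rpow_le_qnorm hq0 P g)

theorem qnorm_const_mul_le (hq : 0 < q) (C : ℝ≥0∞) (f : ℝ → ℝ → ℝ≥0∞) :
    qnorm q a b (fun s t => C * f s t) ≤ C * qnorm q a b f := by
  refine (qnorm_le_iff hq).2 fun P => ?_
  simp only [ENNReal.mul_rpow_of_nonneg _ _ hq.le, ← Finset.mul_sum]
  rw [ENNReal.mul_rpow_of_nonneg _ _ (by positivity), ← ENNReal.rpow_mul,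
    mul_one_div_cancel hq.ne', ENNReal.rpow_one]
  exact mul_le_mul_right (sum_rpow_le_qnorm hq P f) C

theorem sum_rpow_le_rpow_sum {ι : Type*} (s : Finset ι) (f : ι → ℝ≥0∞) {r : ℝ} (hr : 1 ≤ r) :
    ∑ i ∈ s, f i ^ r ≤ (∑ i ∈ s, f i) ^ r := by
  classical
  induction s using Finset.induction_on with
  | empty => simp
  | insert i s hi ih =>
    rw [Finset.sum_insert hi, Finset.sum_insert hi]
    exact (add_le_add_right ih _).trans (ENNReal.add_rpow_le_rpow_add _ _ hr)

/-- The `ℓ^q` norm of a finite family decreases in `q`, so this holds partition by partition. -/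
theorem qnorm_antitone {q' : ℝ} (hq : 0 < q) (hqq' : q ≤ q') (f : ℝ → ℝ → ℝ≥0∞) :
    qnorm q' a b f ≤ qnorm q a b f := by
  have hq' : 0 < q' := hq.trans_le hqq'
  refine (qnorm_le_iff hq').2 fun P => le_trans ?_ (sum_rpow_le_qnorm hq P f)
  have h := sum_rpow_le_rpow_sum (Finset.range P.N)
    (fun i => f (P.u i) (P.u (i + 1)) ^ q) (r := q' / q) ((one_le_div hq).2 hqq')
  simp only [← ENNReal.rpow_mul, mul_div_cancel₀ q' hq.ne'] at h
  refine (ENNReal.rpow_le_rpow h (by positivity)).trans (le_of_eq ?_)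
  rw [← ENNReal.rpow_mul]
  congr 1
  field_simp

theorem qnorm_half_sq (f : ℝ → ℝ → ℝ≥0∞) :
    qnorm (q / 2) a b (fun s t => f s t ^ 2) = qnorm q a b f ^ 2 := by
  simp only [qnorm]
  rw [← ENNReal.rpow_natCast, ← ENNReal.rpow_mul]
  congr 1
  · congr 1
    ext s t
    rw [← ENNReal.rpow_natCast, ← ENNReal.rpow_mul]
    congr 1
    push_cast
    ring
  · push_cast
    rw [one_div_div]
    ring

/-- Sums of a superadditive majorant along a partition collapse to its value on the whole interval;
this is how a pointwise bound by a control becomes a variation bound. -/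
theorem qnorm_le_of_superadditive (hq : 0 < q)
    (hfg : ∀ s t, a ≤ s → s < t → t ≤ b → f s t ^ q ≤ g s t)
    (hg : ∀ r s t, a ≤ r → r ≤ s → s ≤ t → t ≤ b → g r s + g s t ≤ g r t) :
    qnorm q a b f ≤ g a b ^ (1 / q) :=
  ENNReal.rpow_le_rpow (supSum_le_of_superadditive hfg hg) (by positivity)

/-- Repeated points are allowed because `f` vanishes on the diagonal. They occur when a partition is
clipped at an intermediate time by a minimum or a maximum. -/
theorem sum_le_supSum_of_monotone {u : ℕ → ℝ} {n : ℕ} (hf : ∀ s, f s s = 0)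
    (hu : ∀ i < n, u i ≤ u (i + 1)) (ha : ∀ i ≤ n, u i ∈ Set.Icc a b) :
    ∑ i ∈ Finset.range n, f (u i) (u (i + 1)) ≤ supSum a b f := by
  obtain ⟨h1, h2⟩ := sum_le_of_superadditive (g := fun s t => supSum s t f) hu ha
    (fun r s t _ h1 h2 _ => supSum_add_le h1 h2 f)
  refine le_trans (Finset.sum_le_sum fun i hi => ?_)
    (h2.trans (supSum_mono_interval (ha 0 (by omega)).1 h1 (ha n le_rfl).2 f))
  rcases (hu i (Finset.mem_range.1 hi)).eq_or_lt with h | h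
  · rw [← h, hf]
    exact zero_le
  · exact le_supSum h f

/-- The `q`-variation over a union of two intervals, for a function that is subadditive up to a
constant. -/
theorem qnorm_le_add_add {K : ℝ≥0∞} (hq : 1 ≤ q) (hab : a ≤ b) (hbc : b ≤ c)
    (hf : ∀ s, f s s = 0)
    (hK : ∀ r s t, a ≤ r → r ≤ s → s ≤ t → t ≤ c → f r t ≤ f r s + f s t + K) :
    qnorm q a c f ≤ qnorm q a b f + qnorm q b c f + K := by
  classical
  have hq0 : 0 < q := by linarith
  refine (qnorm_le_iff hq0).2 fun P => ?_
  -- Only an interval with `b` in its interior has to be split and pays `K`. There is at most one in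
  -- a partition, which is expressed by `e` being superadditive, so that its sum is at most `K ^ q`.
  set e : ℝ → ℝ → ℝ≥0∞ := fun s t => if s < b ∧ b < t then K ^ q else 0 with he
  have hpt : ∀ i ∈ Finset.range P.N, f (P.u i) (P.u (i + 1)) ≤
      f (P.u i ⊓ b) (P.u (i + 1) ⊓ b) + f (P.u i ⊔ b) (P.u (i + 1) ⊔ b) +
        (e (P.u i) (P.u (i + 1))) ^ (1 / q) := by
    intro i hi
    have hi := Finset.mem_range.1 hi
    have hlt := P.lt_succ i hi
    rcases le_or_gt (P.u (i + 1)) b with h | h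
    · rw [inf_eq_left.2 h, inf_eq_left.2 (hlt.le.trans h), add_assoc]
      exact le_self_add
    · rcases le_or_gt b (P.u i) with h' | h'
      · rw [sup_eq_left.2 h', sup_eq_left.2 h.le]
        exact le_trans le_add_self le_self_add
      · rw [inf_eq_left.2 h'.le, inf_eq_right.2 h.le, sup_eq_right.2 h'.le, sup_eq_left.2 h.le,
          he]
        simp only [h, h', and_self, if_true]
        rw [← ENNReal.rpow_mul, mul_one_div_cancel hq0.ne', ENNReal.rpow_one]
        exact hK _ _ _ (P.mem_Icc hi.le).1 h'.le h.le (P.mem_Icc hi).2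
  have hf' : ∀ s, f s s ^ q = 0 := fun s => by rw [hf, ENNReal.zero_rpow_of_pos hq0]
  have h1 : (∑ i ∈ Finset.range P.N, f (P.u i ⊓ b) (P.u (i + 1) ⊓ b) ^ q) ^ (1 / q) ≤
      qnorm q a b f := by
    refine ENNReal.rpow_le_rpow ?_ (by positivity)
    exact sum_le_supSum_of_monotone (u := fun i => P.u i ⊓ b) (f := fun s t => f s t ^ q) hf'
      (fun i hi => inf_le_inf_right _ (P.lt_succ i hi).le)
      (fun i hi => ⟨le_inf (P.mem_Icc hi).1 hab, inf_le_right⟩)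
  have h2 : (∑ i ∈ Finset.range P.N, f (P.u i ⊔ b) (P.u (i + 1) ⊔ b) ^ q) ^ (1 / q) ≤
      qnorm q b c f := by
    refine ENNReal.rpow_le_rpow ?_ (by positivity)
    exact sum_le_supSum_of_monotone (u := fun i => P.u i ⊔ b) (f := fun s t => f s t ^ q) hf'
      (fun i hi => sup_le_sup_right (P.lt_succ i hi).le _)
      (fun i hi => ⟨le_sup_right, sup_le (P.mem_Icc hi).2 hbc⟩)
  have h3 : (∑ i ∈ Finset.range P.N, ((e (P.u i) (P.u (i + 1))) ^ (1 / q)) ^ q) ^ (1 / q) ≤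
      K := by
    simp only [← ENNReal.rpow_mul, one_div_mul_cancel hq0.ne', ENNReal.rpow_one]
    rw [one_div, ENNReal.rpow_inv_le_iff hq0]
    refine (sum_le_of_superadditive (u := P.u) (n := P.N) (a := a) (b := c) (g := e)
      (fun i hi => (P.lt_succ i hi).le) (fun i hi => P.mem_Icc hi) ?_).2.trans ?_
    · intro r s t _ hrs hst _
      simp only [he]
      by_cases h1 : r < b ∧ b < s
      · rw [if_pos h1, if_neg (fun h => absurd (h.1.trans h1.2) (lt_irrefl s)),
          if_pos ⟨h1.1, h1.2.trans_le hst⟩, add_zero]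
      · rw [if_neg h1, zero_add]
        by_cases h2 : s < b ∧ b < t
        · rw [if_pos h2, if_pos ⟨hrs.trans_lt h2.1, h2.2⟩]
        · rw [if_neg h2]
          exact zero_le
    · simp only [he]
      split_ifs
      · exact le_rfl
      · exact zero_le
  calc (∑ i ∈ Finset.range P.N, f (P.u i) (P.u (i + 1)) ^ q) ^ (1 / q)
      ≤ (∑ i ∈ Finset.range P.N, (f (P.u i ⊓ b) (P.u (i + 1) ⊓ b) +
          f (P.u i ⊔ b) (P.u (i + 1) ⊔ b) + (e (P.u i) (P.u (i + 1))) ^ (1 / q)) ^ q) ^ (1 / q) :=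
        ENNReal.rpow_le_rpow (Finset.sum_le_sum fun i hi =>
          ENNReal.rpow_le_rpow (hpt i hi) hq0.le) (by positivity)
    _ ≤ _ := (ENNReal.Lp_add_le _ _ _ hq).trans
        (add_le_add ((ENNReal.Lp_add_le _ _ _ hq).trans (add_le_add h1 h2)) h3)

/-- Iteration of `qnorm_le_add_add` along an equidistant partition. -/
theorem qnorm_le_nat_mul {K B : ℝ≥0∞} {h : ℝ} (hq : 1 ≤ q) (hh : 0 ≤ h) (n : ℕ)
    (hf : ∀ s, f s s = 0)
    (hK : ∀ r s t, 0 ≤ r → r ≤ s → s ≤ t → t ≤ n * h → f r t ≤ f r s + f s t + K)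
    (hB : ∀ i < n, qnorm q (i * h) ((i + 1 : ℕ) * h) f ≤ B) :
    qnorm q 0 (n * h) f ≤ n * (B + K) := by
  induction n with
  | zero =>
    refine (qnorm_le_iff (by linarith)).2 fun P => ?_
    have hN : P.N = 0 := by
      by_contra hN
      have h1 := P.lt_succ 0 (by omega)
      have h2 := (P.mem_Icc (i := 1) (by omega)).2
      rw [P.first] at h1
      simp only [zero_add] at h1
      simp at h2
      linarith
    rw [hN]
    simp [show 0 < q by linarith]
  | succ n ih =>
    have hle : (n : ℝ) * h ≤ ((n + 1 : ℕ) : ℝ) * h := by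
      push_cast
      linarith
    refine (qnorm_le_add_add (b := n * h) hq (by positivity) hle hf hK).trans ?_
    have h1 := ih (fun r s t h0 h1 h2 h3 => hK r s t h0 h1 h2 (h3.trans hle))
      (fun i hi => hB i (by omega))
    have h2 := hB n (by omega)
    calc _ ≤ (n * (B + K)) + B + K := by gcongr
      _ = _ := by push_cast; ring

end supSum

/-! ### The sewing lemma -/

/-- The constant of the sewing lemma. -/
noncomputable def sewingConst (θ : ℝ) : ℝ := 2 / (1 - 2 * (1 / 2) ^ θ)

theorem two_mul_half_rpow_lt_one {θ : ℝ} (hθ : 1 < θ) : 2 * (1 / 2 : ℝ) ^ θ < 1 := by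
  have h : (1 / 2 : ℝ) ^ θ < (1 / 2 : ℝ) ^ (1 : ℝ) :=
    Real.rpow_lt_rpow_of_exponent_gt (by norm_num) (by norm_num) hθ
  rw [Real.rpow_one] at h
  linarith

theorem sewingConst_pos {θ : ℝ} (hθ : 1 < θ) : 0 < sewingConst θ :=
  div_pos two_pos (by linarith [two_mul_half_rpow_lt_one hθ])

/-- The fixed point equation of the induction below: two pieces of at most half the control, each
contributing `(1/2)^θ`, plus two defects. -/
theorem sewingConst_eq {θ : ℝ} (hθ : 1 < θ) :
    sewingConst θ * (2 * (1 / 2) ^ θ) + 2 = sewingConst θ := by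
  have h : (1 - 2 * (1 / 2 : ℝ) ^ θ) ≠ 0 := by linarith [two_mul_half_rpow_lt_one hθ]
  unfold sewingConst
  field_simp
  ring

/-- A discrete sewing lemma. -/
theorem norm_sum_sub_le_of_superadditive {E : Type*} [NormedAddCommGroup E] {N : ℕ} {θ K : ℝ}
    (hθ : 1 < θ) (hK : 0 ≤ K) (F : ℕ → ℕ → E) (w : ℕ → ℕ → ℝ) (hF : ∀ i, F i i = 0)
    (hw0 : ∀ i j, i ≤ j → j ≤ N → 0 ≤ w i j)
    (hw : ∀ i j l, i ≤ j → j ≤ l → l ≤ N → w i j + w j l ≤ w i l)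
    (hδ : ∀ i j l, i ≤ j → j ≤ l → l ≤ N → ‖F i l - F i j - F j l‖ ≤ K * w i l ^ θ)
    {a b : ℕ} (hab : a ≤ b) (hb : b ≤ N) :
    ‖(∑ i ∈ Finset.Ico a b, F i (i + 1)) - F a b‖ ≤ sewingConst θ * K * w a b ^ θ := by
  obtain ⟨n, hn⟩ : ∃ n, b - a = n := ⟨_, rfl⟩
  induction n using Nat.strong_induction_on generalizing a b with
  | _ n ih =>
  have hC := (sewingConst_pos hθ).le
  rcases hab.eq_or_lt with rfl | hlt
  · simp only [Finset.Ico_self, Finset.sum_empty, hF, sub_zero, norm_zero]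
    have := hw0 a a le_rfl hb
    positivity
  have hwab := hw0 a b hab hb
  -- Take the first `j > a` at which the control from `a` exceeds half its total, or `b` if there is
  -- none. With `j = i + 1`, minimality bounds `w a i` by one half and superadditivity bounds `w
  -- (i+1) b` by one half. Cutting at both `i` and `i + 1` leaves two shorter halved pieces and one
  -- exact term.
  have hex : ∃ j, a < j ∧ (w a b / 2 < w a j ∨ j = b) := ⟨b, hlt, Or.inr rfl⟩
  classical
  obtain ⟨hj1, hj2⟩ := Nat.find_spec hex
  have hjb : Nat.find hex ≤ b := Nat.find_min' hex ⟨hlt, Or.inr rfl⟩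
  have hmin := fun m => Nat.find_min hex (m := m)
  generalize Nat.find hex = j at hj1 hj2 hjb hmin
  obtain ⟨i, rfl⟩ : ∃ i, j = i + 1 := ⟨j - 1, by omega⟩
  have hdiag : ∀ l ≤ N, w l l ≤ 0 := fun l hl => by linarith [hw l l l le_rfl le_rfl hl]
  have h1 : w a i ≤ w a b / 2 := by
    rcases (Nat.lt_succ_iff.1 hj1).eq_or_lt with h | h
    · rw [← h]
      exact (hdiag a (by omega)).trans (by linarith)
    · by_contra hcon
      exact hmin i (by omega) ⟨h, Or.inl (not_le.1 hcon)⟩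
  have h2 : w (i + 1) b ≤ w a b / 2 := by
    rcases hj2 with h | h
    · linarith [hw a (i + 1) b hj1.le hjb hb]
    · rw [h]
      exact (hdiag b hb).trans (by linarith)
  have hai : a ≤ i := by omega
  have e1 := ih (i - a) (by omega) hai (by omega) rfl
  have e2 := ih (b - (i + 1)) (by omega) hjb hb rfl
  have d1 := hδ a i b hai (by omega) hb
  have d2 := hδ i (i + 1) b (by omega) hjb hb
  have hib : w i b ≤ w a b := by linarith [hw a i b hai (by omega) hb, hw0 a i hai (by omega)]
  have hmono : ∀ x, 0 ≤ x → x ≤ w a b / 2 → x ^ θ ≤ w a b ^ θ * (1 / 2) ^ θ := by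
    intro x hx hx'
    rw [← Real.mul_rpow hwab (by norm_num)]
    exact Real.rpow_le_rpow hx (by linarith) (by linarith)
  have m1 := hmono _ (hw0 a i hai (by omega)) h1
  have m2 := hmono _ (hw0 (i + 1) b hjb hb) h2
  have m3 : w i b ^ θ ≤ w a b ^ θ :=
    Real.rpow_le_rpow (hw0 i b (by omega) hb) hib (by linarith)
  have hsum : (∑ l ∈ Finset.Ico a b, F l (l + 1)) = (∑ l ∈ Finset.Ico a i, F l (l + 1)) +
      (F i (i + 1) + ∑ l ∈ Finset.Ico (i + 1) b, F l (l + 1)) := by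
    rw [← Finset.sum_Ico_consecutive _ hai (by omega : i ≤ b),
      Finset.sum_eq_sum_Ico_succ_bot (by omega : i < b)]
  have hdec : (∑ l ∈ Finset.Ico a b, F l (l + 1)) - F a b =
      ((∑ l ∈ Finset.Ico a i, F l (l + 1)) - F a i) +
      ((∑ l ∈ Finset.Ico (i + 1) b, F l (l + 1)) - F (i + 1) b) -
      (F a b - F a i - F i b) - (F i b - F i (i + 1) - F (i + 1) b) := by
    rw [hsum]
    abel
  rw [hdec]
  have hCK : 0 ≤ sewingConst θ * K := mul_nonneg hC hK
  calc _ ≤ sewingConst θ * K * w a i ^ θ + sewingConst θ * K * w (i + 1) b ^ θ +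
        K * w a b ^ θ + K * w i b ^ θ := by
        refine (norm_sub_le _ _).trans (add_le_add ((norm_sub_le _ _).trans (add_le_add
          ((norm_add_le _ _).trans (add_le_add e1 e2)) d1)) d2)
    _ ≤ sewingConst θ * K * (w a b ^ θ * (1 / 2) ^ θ) +
        sewingConst θ * K * (w a b ^ θ * (1 / 2) ^ θ) + K * w a b ^ θ + K * w a b ^ θ := by
        gcongr
    _ = (sewingConst θ * (2 * (1 / 2) ^ θ) + 2) * K * w a b ^ θ := by ring
    _ = _ := by rw [sewingConst_eq hθ]

/-- The sewing estimate for the Riemann sums along a partition. -/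
theorem norm_partition_sum_sub_le {E : Type*} [NormedAddCommGroup E] {a b s t θ K : ℝ}
    (hθ : 1 < θ) (hK : 0 ≤ K) (F : ℝ → ℝ → E) (w : ℝ → ℝ → ℝ)
    (has : a ≤ s) (htb : t ≤ b) (hF : ∀ r ∈ Set.Icc a b, F r r = 0)
    (hw0 : ∀ r u, a ≤ r → r ≤ u → u ≤ b → 0 ≤ w r u)
    (hw : ∀ r u v, a ≤ r → r ≤ u → u ≤ v → v ≤ b → w r u + w u v ≤ w r v)
    (hδ : ∀ r u v, a ≤ r → r ≤ u → u ≤ v → v ≤ b → ‖F r v - F r u - F u v‖ ≤ K * w r v ^ θ)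
    (P : Partition s t) :
    ‖(∑ i ∈ Finset.range P.N, F (P.u i) (P.u (i + 1))) - F s t‖ ≤
      sewingConst θ * K * w s t ^ θ := by
  -- Clamping the index at `P.N` makes the sequence monotone on all of `ℕ`; the values of `P.u`
  -- beyond `P.N` are arbitrary.
  set v : ℕ → ℝ := fun i => P.u (min i P.N) with hv
  have hvmem : ∀ i, v i ∈ Set.Icc a b := fun i =>
    ⟨has.trans (P.mem_Icc (min_le_right _ _)).1, (P.mem_Icc (min_le_right _ _)).2.trans htb⟩
  have hvm : ∀ i j, i ≤ j → v i ≤ v j := fun i j hij =>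
    P.mono (min_le_min_right _ hij) (min_le_right _ _)
  have h := norm_sum_sub_le_of_superadditive (N := P.N) hθ hK (fun i j => F (v i) (v j))
    (fun i j => w (v i) (v j)) (fun i => hF _ (hvmem i))
    (fun i j hij _ => hw0 _ _ (hvmem i).1 (hvm i j hij) (hvmem j).2)
    (fun i j l hij hjl _ => hw _ _ _ (hvmem i).1 (hvm i j hij) (hvm j l hjl) (hvmem l).2)
    (fun i j l hij hjl _ => hδ _ _ _ (hvmem i).1 (hvm i j hij) (hvm j l hjl) (hvmem l).2)
    (Nat.zero_le P.N) le_rfl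
  have h0 : v 0 = s := by simp [hv, P.first]
  have hN : v P.N = t := by simp [hv, P.last]
  rw [h0, hN, ← Finset.range_eq_Ico] at h
  convert h using 4 with i hi
  have hi := Finset.mem_range.1 hi
  simp only [hv]
  rw [min_eq_left hi.le, min_eq_left (Nat.succ_le_of_lt hi)]

/-! ### Quantitative bounds for the coefficients -/

/-- Quantitative consequences of `IsCb 2 f`, for the partial derivative of `f` in its first
argument. -/
structure HasCbBound {m k d n : ℕ} (f : Vec m × Vec k → Lin d n) (M : ℝ) : Prop where
  norm_le : ∀ z, ‖f z‖ ≤ M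
  lipschitz : ∀ z z', ‖f z' - f z‖ ≤ M * ‖z' - z‖
  fderiv_le : ∀ z : Vec m × Vec k, ‖fderiv ℝ (fun x => f (x, z.2)) z.1‖ ≤ M
  fderiv_lipschitz : ∀ z z' : Vec m × Vec k,
    ‖fderiv ℝ (fun x => f (x, z'.2)) z'.1 - fderiv ℝ (fun x => f (x, z.2)) z.1‖ ≤ M * ‖z' - z‖
  taylor : ∀ x x' y, ‖f (x', y) - f (x, y) - fderiv ℝ (fun x => f (x, y)) x (x' - x)‖ ≤
    M * ‖x' - x‖ ^ 2

theorem norm_fderiv_sub_le_of_iteratedFDeriv_two {E G : Type*} [NormedAddCommGroup E]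
    [NormedSpace ℝ E] [NormedAddCommGroup G] [NormedSpace ℝ G] {f : E → G} {M : ℝ}
    (hf : ContDiff ℝ 2 f) (hM : ∀ z, ‖iteratedFDeriv ℝ 2 f z‖ ≤ M) (z z' : E) :
    ‖fderiv ℝ f z' - fderiv ℝ f z‖ ≤ M * ‖z' - z‖ := by
  have hd : Differentiable ℝ (fderiv ℝ f) :=
    (hf.fderiv_right (m := 1) (by norm_num)).differentiable (by simp)
  refine convex_univ.norm_image_sub_le_of_norm_fderiv_le (𝕜 := ℝ) (fun x _ => hd x)
    (fun x _ => ?_) (Set.mem_univ z) (Set.mem_univ z')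
  have := hM x
  rwa [← norm_iteratedFDeriv_fderiv, norm_iteratedFDeriv_one] at this

section Cb

variable {m k d n : ℕ} {f : Vec m × Vec k → Lin d n} {M : ℝ}

theorem HasCbBound.nonneg (h : HasCbBound f M) : 0 ≤ M := (norm_nonneg _).trans (h.norm_le 0)

theorem HasCbBound.mono {M' : ℝ} (h : HasCbBound f M) (hM : M ≤ M') : HasCbBound f M' where
  norm_le z := (h.norm_le z).trans hM
  lipschitz z z' := (h.lipschitz z z').trans (by gcongr)
  fderiv_le z := (h.fderiv_le z).trans hM
  fderiv_lipschitz z z' := (h.fderiv_lipschitz z z').trans (by gcongr)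
  taylor x x' y := (h.taylor x x' y).trans (by gcongr)

theorem IsCb.exists_hasCbBound (hf : IsCb 2 f) : ∃ M, HasCbBound f M := by
  obtain ⟨M, hM⟩ := hf.bounded
  have hd : Differentiable ℝ f := hf.contDiff.differentiable (by simp)
  have h0 : ∀ z, ‖f z‖ ≤ M := fun z => by
    simpa using hM 0 (by norm_num) z
  have h1 : ∀ z, ‖fderiv ℝ f z‖ ≤ M := fun z => by
    simpa [norm_iteratedFDeriv_one] using hM 1 (by norm_num) z
  have hM0 : 0 ≤ M := (norm_nonneg _).trans (h0 0)
  have hpd : ∀ (x : Vec m) (y : Vec k), HasFDerivAt (fun x => f (x, y))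
      ((fderiv ℝ f (x, y)).comp (ContinuousLinearMap.inl ℝ (Vec m) (Vec k))) x := fun x y =>
    (hd (x, y)).hasFDerivAt.comp x (hasFDerivAt_prodMk_left x y)
  have hinl : ‖ContinuousLinearMap.inl ℝ (Vec m) (Vec k)‖ ≤ 1 :=
    ContinuousLinearMap.norm_inl_le_one ℝ _ _
  have hlip2 : ∀ z z', ‖fderiv ℝ f z' - fderiv ℝ f z‖ ≤ M * ‖z' - z‖ := 
    norm_fderiv_sub_le_of_iteratedFDeriv_two hf.contDiff (hM 2 le_rfl)
  have hplip : ∀ z z' : Vec m × Vec k,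
      ‖fderiv ℝ (fun x => f (x, z'.2)) z'.1 - fderiv ℝ (fun x => f (x, z.2)) z.1‖ ≤
        M * ‖z' - z‖ := fun z z' => by
    rw [(hpd z.1 z.2).fderiv, (hpd z'.1 z'.2).fderiv, ← ContinuousLinearMap.sub_comp]
    refine (ContinuousLinearMap.opNorm_comp_le _ _).trans ?_
    calc _ ≤ (M * ‖z' - z‖) * 1 := mul_le_mul (hlip2 z z') hinl (norm_nonneg _) (by positivity)
      _ = _ := mul_one _
  refine ⟨M, h0, fun z z' => ?_, fun z => ?_, hplip, fun x x' y => ?_⟩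
  · exact convex_univ.norm_image_sub_le_of_norm_fderiv_le (fun x _ => hd x) (fun x _ => h1 x)
      (Set.mem_univ z) (Set.mem_univ z')
  · rw [(hpd z.1 z.2).fderiv]
    refine (ContinuousLinearMap.opNorm_comp_le _ _).trans ?_
    calc _ ≤ M * 1 := mul_le_mul (h1 _) hinl (norm_nonneg _) hM0
      _ = _ := mul_one _
  -- Mean value inequality on the ball of radius `‖x' - x‖`, where the derivative differs from its
  -- value at the centre by at most `M * ‖x' - x‖`.
  · have := (convex_closedBall x ‖x' - x‖).norm_image_sub_le_of_norm_fderiv_le'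
      (f := fun x => f (x, y)) (φ := fderiv ℝ (fun x => f (x, y)) x) (C := M * ‖x' - x‖)
      (x := x) (y := x') (𝕜 := ℝ)
      (fun z _ => (hpd z y).differentiableAt) (fun z hz => ?_)
      (Metric.mem_closedBall_self (norm_nonneg _)) (by simp [dist_eq_norm])
    · calc _ ≤ M * ‖x' - x‖ * ‖x' - x‖ := this
        _ = _ := by ring
    · have h := hplip (x, y) (z, y)
      refine h.trans (mul_le_mul_of_nonneg_left ?_ hM0)
      simpa [dist_eq_norm, Prod.norm_def] using hz

theorem IsLipB.exists_bound {b : Vec m × Vec k → Vec m} (hb : IsLipB b) :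
    Continuous b ∧ ∃ M, ∀ z, ‖b z‖ ≤ M := by
  obtain ⟨K, hK⟩ := hb.lipschitz
  exact ⟨hK.continuous, hb.bounded⟩

end Cb

/-! ### The action on tensors and the germ of the rough integral -/

theorem tensorApply_add {F : Type*} [NormedAddCommGroup F] [NormedSpace ℝ F] {d : ℕ}
    (A B : Vec d →L[ℝ] Vec d →L[ℝ] F) (z : Vec d ⊗[ℝ] Vec d) :
    tensorApply (A + B) z = tensorApply A z + tensorApply B z := by
  unfold tensorApply
  induction z using TensorProduct.induction_on with
  | zero => simp
  | tmul x y => simp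
  | add x y hx hy => rw [map_add, hx, hy, map_add, map_add]; abel

/-- Expand `z` in the orthonormal basis `e i ⊗ e j`: each of the `d * d` coefficients is at most
`‖z‖`, and each value `A (e i) (e j)` has norm at most `‖A‖`. The constant is crude but depends only
on the dimension. -/
theorem norm_tensorApply_le {F : Type*} [NormedAddCommGroup F] [NormedSpace ℝ F] {d : ℕ}
    (A : Vec d →L[ℝ] Vec d →L[ℝ] F) (z : Vec d ⊗[ℝ] Vec d) :
    ‖tensorApply A z‖ ≤ (d * d : ℝ) * ‖A‖ * ‖z‖ := by
  let e := EuclideanSpace.basisFun (Fin d) ℝ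
  let B := e.tensorProduct e
  have hz : tensorApply A z = ∑ i, (inner ℝ (B i) z : ℝ) • tensorApply A (B i) := by
    conv_lhs => rw [← B.sum_repr' z]
    simp [tensorApply]
  have hB : ∀ i, ‖tensorApply A (B i)‖ ≤ ‖A‖ := by
    rintro ⟨i, j⟩
    have : tensorApply A (B (i, j)) = A (e i) (e j) := by
      simp [B, tensorApply, OrthonormalBasis.tensorProduct_apply]
    rw [this]
    refine (A.le_opNorm₂ _ _).trans ?_
    simp [e]
  rw [hz]
  calc _ ≤ ∑ i : Fin d × Fin d, ‖z‖ * ‖A‖ := by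
        refine norm_sum_le_of_le _ fun i _ => ?_
        rw [norm_smul]
        refine mul_le_mul ?_ (hB i) (norm_nonneg _) (norm_nonneg _)
        refine (norm_inner_le_norm _ _).trans ?_
        simp [B.norm_eq_one]
    _ = _ := by
        simp
        ring

/-- The increment over `[r, t]` of the germ of the rough integral, minus those over `[r, s]` and
`[s, t]`. -/
theorem germ_sub_sub {F : Type*} [NormedAddCommGroup F] [NormedSpace ℝ F] {d : ℕ} {p T : ℝ}
    (Z : RoughPath d p T) (Y : ℝ → Vec d →L[ℝ] F) (Y' : ℝ → Vec d →L[ℝ] Vec d →L[ℝ] F)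
    {r s t : ℝ} (hr : 0 ≤ r) (hrs : r ≤ s) (hst : s ≤ t) (ht : t ≤ T) :
    (Y r (incr Z.path r t) + tensorApply (Y' r) (Z.enh r t)) -
      (Y r (incr Z.path r s) + tensorApply (Y' r) (Z.enh r s)) -
      (Y s (incr Z.path s t) + tensorApply (Y' s) (Z.enh s t)) =
    -(remainder Z.path Y Y' r s (incr Z.path s t) + tensorApply (incr Y' r s) (Z.enh s t)) := by
  have h1 : incr Z.path r t = incr Z.path r s + incr Z.path s t := by
    simp [incr]
  have h2 : tensorApply (Y' r) (Z.enh r t) = tensorApply (Y' r) (Z.enh r s) +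
      tensorApply (Y' r) (Z.enh s t) + Y' r (incr Z.path r s) (incr Z.path s t) := by
    rw [Z.chen r s t hr hrs hst ht]
    simp [tensorApply]
  have h3 : tensorApply (Y' s) (Z.enh s t) =
      tensorApply (Y' r) (Z.enh s t) + tensorApply (incr Y' r s) (Z.enh s t) := by
    rw [← tensorApply_add]
    simp [incr]
  rw [h1, h2, h3, map_add]
  simp only [remainder, incr, sub_apply]
  abel

theorem RoughPath.enh_self {d : ℕ} {p T : ℝ} (Z : RoughPath d p T) {s : ℝ} (hs : 0 ≤ s)
    (hs' : s ≤ T) : Z.enh s s = 0 := by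
  have h := Z.chen s s s hs le_rfl le_rfl hs'
  simpa [incr] using h

/-- The pointwise form of a bound on the Hölder norm. -/
theorem norm_le_of_holder2_le {E : Type*} [NormedAddCommGroup E] {α T L : ℝ} {A : ℝ → ℝ → E}
    (hL : 0 ≤ L) (h : holder2 α T A ≤ ENNReal.ofReal L) {s t : ℝ} (hs : 0 ≤ s) (hst : s < t)
    (ht : t ≤ T) : ‖A s t‖ ≤ L * (t - s) ^ α := by
  have hpos : 0 < (t - s) ^ α := Real.rpow_pos_of_pos (sub_pos.2 hst) _
  have h1 : ‖A s t‖ₑ / ENNReal.ofReal ((t - s) ^ α) ≤ ENNReal.ofReal L := by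
    refine le_trans ?_ h
    unfold holder2
    exact le_iSup_of_le s (le_iSup_of_le t (le_iSup_of_le ⟨hs, hst, ht⟩ le_rfl))
  rw [ENNReal.div_le_iff (by simpa using hpos) (by simp), ← ENNReal.ofReal_mul hL,
    ← ofReal_norm, ENNReal.ofReal_le_ofReal_iff (by positivity)] at h1
  exact h1

theorem norm_comp_sub_comp_le {E F G : Type*} [NormedAddCommGroup E] [NormedSpace ℝ E]
    [NormedAddCommGroup F] [NormedSpace ℝ F] [NormedAddCommGroup G] [NormedSpace ℝ G]
    (A A' : F →L[ℝ] G) (B B' : E →L[ℝ] F) :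
    ‖A'.comp B' - A.comp B‖ ≤ ‖A' - A‖ * ‖B'‖ + ‖A‖ * ‖B' - B‖ := by
  have e : A'.comp B' - A.comp B = (A' - A).comp B' + A.comp (B' - B) := by
    rw [ContinuousLinearMap.sub_comp, ContinuousLinearMap.comp_sub]
    abel
  rw [e]
  exact (norm_add_le _ _).trans (add_le_add (ContinuousLinearMap.opNorm_comp_le _ _)
    (ContinuousLinearMap.opNorm_comp_le _ _))

/-! ### Pointwise estimates for `f(X, γ)` -/

section Composition

variable {m k d n : ℕ} {f : Vec m × Vec k → Lin d n} {lam : Vec m × Vec k → Lin d m} {M : ℝ}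
  (X : ℝ → Vec m) (γ : ℝ → Vec k)

theorem norm_pair_sub_le (s t : ℝ) :
    ‖((X t, γ t) : Vec m × Vec k) - (X s, γ s)‖ ≤ ‖incr X s t‖ + ‖incr γ s t‖ := by
  rw [Prod.norm_def]
  exact max_le (le_add_of_nonneg_right (norm_nonneg _)) (le_add_of_nonneg_left (norm_nonneg _))

theorem norm_compDeriv_le (hf : HasCbBound f M) (hl : HasCbBound lam M) (s : ℝ) :
    ‖compDeriv f X γ (comp lam X γ) s‖ ≤ M ^ 2 := by
  refine (ContinuousLinearMap.opNorm_comp_le _ _).trans ?_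
  rw [sq]
  exact mul_le_mul (hf.fderiv_le (X s, γ s)) (hl.norm_le _) (norm_nonneg _) hf.nonneg

theorem norm_incr_compDeriv_le (hf : HasCbBound f M) (hl : HasCbBound lam M) (s t : ℝ) :
    ‖incr (compDeriv f X γ (comp lam X γ)) s t‖ ≤
      2 * M ^ 2 * (‖incr X s t‖ + ‖incr γ s t‖) := by
  have hM := hf.nonneg
  set D := fun s => fderiv ℝ (fun x => f (x, γ s)) (X s) with hD
  have hz := norm_pair_sub_le X γ s t
  refine (norm_comp_sub_comp_le (D s) (D t) (comp lam X γ s) (comp lam X γ t)).trans ?_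
  have h1 : ‖D t - D s‖ * ‖comp lam X γ t‖ ≤ (M * (‖incr X s t‖ + ‖incr γ s t‖)) * M := by
    refine (mul_le_mul ?_ (hl.norm_le _) (norm_nonneg _) (by positivity))
    exact (hf.fderiv_lipschitz (X s, γ s) (X t, γ t)).trans (by gcongr)
  have h2 : ‖D s‖ * ‖comp lam X γ t - comp lam X γ s‖ ≤
      M * (M * (‖incr X s t‖ + ‖incr γ s t‖)) := by
    refine (mul_le_mul (hf.fderiv_le (X s, γ s)) ?_ (norm_nonneg _) hM)
    exact (hl.lipschitz (X s, γ s) (X t, γ t)).trans (by gcongr)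
  refine (add_le_add h1 h2).trans (le_of_eq ?_)
  ring

/-- The first order Taylor error of `f(·, y)` enters the remainder of `f(X, γ)`. -/
theorem norm_remainder_comp_le_taylor (ζ : ℝ → Vec d) (hf : HasCbBound f M) (s t : ℝ) :
    ‖remainder ζ (comp f X γ) (compDeriv f X γ (comp lam X γ)) s t‖ ≤
      M * ‖incr γ s t‖ + ‖f (X t, γ s) - f (X s, γ s) -
        fderiv ℝ (fun x => f (x, γ s)) (X s) (X t - X s)‖ +
        M * ‖remainder ζ X (comp lam X γ) s t‖ := by
  have hM := hf.nonneg
  have e : remainder ζ (comp f X γ) (compDeriv f X γ (comp lam X γ)) s t =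
      (f (X t, γ t) - f (X t, γ s)) + (f (X t, γ s) - f (X s, γ s) -
        fderiv ℝ (fun x => f (x, γ s)) (X s) (X t - X s)) +
      fderiv ℝ (fun x => f (x, γ s)) (X s) (remainder ζ X (comp lam X γ) s t) := by
    simp only [remainder, incr, comp, compDeriv, map_sub, ContinuousLinearMap.comp_apply]
    abel
  rw [e]
  refine (norm_add_le _ _).trans (add_le_add ((norm_add_le _ _).trans (add_le_add ?_ le_rfl)) ?_)
  · refine (hf.lipschitz (X t, γ s) (X t, γ t)).trans (le_of_eq ?_)
    simp [incr, Prod.norm_def]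
  · exact ((fderiv ℝ (fun x => f (x, γ s)) (X s)).le_opNorm _).trans
      (mul_le_mul_of_nonneg_right (hf.fderiv_le (X s, γ s)) (norm_nonneg _))

theorem norm_remainder_comp_le (ζ : ℝ → Vec d) (hf : HasCbBound f M) (s t : ℝ) :
    ‖remainder ζ (comp f X γ) (compDeriv f X γ (comp lam X γ)) s t‖ ≤
      M * (‖incr X s t‖ ^ 2 + ‖remainder ζ X (comp lam X γ) s t‖ + ‖incr γ s t‖) := by
  have h1 := norm_remainder_comp_le_taylor (lam := lam) X γ ζ hf s t
  have h2 := hf.taylor (X s) (X t) (γ s)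
  simp only [incr] at *
  linarith

theorem norm_incr_le (ζ : ℝ → Vec d) (hl : HasCbBound lam M) (s t : ℝ) :
    ‖incr X s t‖ ≤ M * ‖incr ζ s t‖ + ‖remainder ζ X (comp lam X γ) s t‖ := by
  have e : incr X s t = comp lam X γ s (incr ζ s t) + remainder ζ X (comp lam X γ) s t := by
    simp [remainder]
  rw [e]
  refine (norm_add_le _ _).trans (add_le_add_left ?_ _)
  exact ((comp lam X γ s).le_opNorm _).trans
    (mul_le_mul_of_nonneg_right (hl.norm_le _) (norm_nonneg _))

/-- A bound on the remainder of `f(X, γ)` which is linear in the remainder of `X`. -/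
theorem norm_remainder_comp_le_linear (ζ : ℝ → Vec d) (hf : HasCbBound f M)
    (hl : HasCbBound lam M) (s t : ℝ) :
    ‖remainder ζ (comp f X γ) (compDeriv f X γ (comp lam X γ)) s t‖ ≤
      M * ‖incr γ s t‖ + 4 * M * (M * ‖incr ζ s t‖) ^ 2 +
        5 * M * ‖remainder ζ X (comp lam X γ) s t‖ := by
  have hM := hf.nonneg
  have h1 := norm_remainder_comp_le_taylor (lam := lam) X γ ζ hf s t
  have h2 := hf.taylor (X s) (X t) (γ s)
  have h3 : ‖f (X t, γ s) - f (X s, γ s) - fderiv ℝ (fun x => f (x, γ s)) (X s) (X t - X s)‖ ≤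
      2 * M * ‖X t - X s‖ := by
    refine (norm_sub_le _ _).trans ?_
    have a1 := hf.lipschitz (X s, γ s) (X t, γ s)
    have a2 := ((fderiv ℝ (fun x => f (x, γ s)) (X s)).le_opNorm (X t - X s)).trans
      (mul_le_mul_of_nonneg_right (hf.fderiv_le (X s, γ s)) (norm_nonneg _))
    have a3 : ‖((X t, γ s) : Vec m × Vec k) - (X s, γ s)‖ = ‖X t - X s‖ := by
      simp [Prod.norm_def]
    rw [a3] at a1
    linarith
  have h4 := norm_incr_le X γ ζ hl s t
  have h5 : ‖incr X s t‖ = ‖X t - X s‖ := rfl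
  set e := ‖remainder ζ X (comp lam X γ) s t‖ with he
  have he0 : 0 ≤ e := norm_nonneg _
  set a := M * ‖incr ζ s t‖ with ha
  have ha0 : 0 ≤ a := by positivity
  have hx0 : 0 ≤ ‖X t - X s‖ := norm_nonneg _
  rw [h5] at h4
  -- The increment of `X` is at most `a + e`. If `e ≤ a`, it is at most `2a` and the quadratic
  -- Taylor bound gives `4 M a²`. If `a ≤ e`, it is at most `2e` and the Lipschitz bound gives `4 M
  -- e`. Either way no square of `e` appears.
  rcases le_total e a with h | h
  · have : M * ‖X t - X s‖ ^ 2 ≤ M * (2 * a) ^ 2 := by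
      gcongr
      linarith
    have : 0 ≤ M * e := by positivity
    nlinarith
  · have : 2 * M * ‖X t - X s‖ ≤ 2 * M * (2 * e) := by
      gcongr
      linarith
    have : 0 ≤ M * a ^ 2 := by positivity
    nlinarith

end Composition

/-! ### The local expansion of a solution -/

section Solution

variable {m k d : ℕ} {p T : ℝ} {b : Vec m × Vec k → Vec m} {lam : Vec m × Vec k → Lin d m}
  {Z : RoughPath d p T} {γ : ℝ → Vec k} {x : Vec m} {X : ℝ → Vec m}

/-- The local expansion `Y_s ζ_{s,t} + Y'_s ζ⁽²⁾_{s,t}` of the rough integral. -/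
noncomputable def germ {F : Type*} [NormedAddCommGroup F] [NormedSpace ℝ F]
    (Z : RoughPath d p T) (Y : ℝ → Vec d →L[ℝ] F) (Y' : ℝ → Vec d →L[ℝ] Vec d →L[ℝ] F)
    (s t : ℝ) : F :=
  Y s (incr Z.path s t) + tensorApply (Y' s) (Z.enh s t)

/-- Both integrals start at `0`. A fine partition of `[0,s]` followed by a fine one of `[s,t]` tests
them simultaneously; the sums over `[0,s]` cancel up to `ε`, leaving a Riemann sum over `[s,t]`, to
which `hB` applies. -/
theorem HasRoughIntegral.norm_sub_sub_germ_le {F : Type*} [NormedAddCommGroup F]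
    [NormedSpace ℝ F] {Y : ℝ → Vec d →L[ℝ] F} {Y' : ℝ → Vec d →L[ℝ] Vec d →L[ℝ] F} {s t : ℝ}
    {I J : F} (hs : 0 ≤ s) (hst : s ≤ t) (hI : HasRoughIntegral Z Y Y' 0 s I)
    (hJ : HasRoughIntegral Z Y Y' 0 t J) {B : ℝ}
    (hB : ∀ P : Partition s t, ‖(∑ i ∈ Finset.range P.N, germ Z Y Y' (P.u i) (P.u (i + 1))) -
      germ Z Y Y' s t‖ ≤ B) :
    ‖J - I - germ Z Y Y' s t‖ ≤ B := by
  refine le_of_forall_pos_le_add fun ε hε => ?_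
  obtain ⟨δ₁, hδ₁, h1⟩ := hI (ε / 2) (half_pos hε)
  obtain ⟨δ₂, hδ₂, h2⟩ := hJ (ε / 2) (half_pos hε)
  obtain ⟨P, hP⟩ := Partition.exists_meshLE hs (lt_min hδ₁ hδ₂)
  obtain ⟨Q, hQ⟩ := Partition.exists_meshLE hst hδ₂
  have e1 := h1 P fun i hi => (hP i hi).trans (min_le_left _ _)
  have e2 := h2 (P.concat Q)
    (Partition.MeshLE.concat (fun i hi => (hP i hi).trans (min_le_right _ _)) hQ)
  have e3 := hB Q
  have hsum := Partition.sum_concat P Q (germ Z Y Y')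
  simp only [germ] at hsum e3 ⊢
  rw [hsum] at e2
  set SP := ∑ i ∈ Finset.range P.N, (Y (P.u i) (incr Z.path (P.u i) (P.u (i + 1))) +
    tensorApply (Y' (P.u i)) (Z.enh (P.u i) (P.u (i + 1))))
  set SQ := ∑ i ∈ Finset.range Q.N, (Y (Q.u i) (incr Z.path (Q.u i) (Q.u (i + 1))) +
    tensorApply (Y' (Q.u i)) (Z.enh (Q.u i) (Q.u (i + 1))))
  set g := Y s (incr Z.path s t) + tensorApply (Y' s) (Z.enh s t)
  have e : J - I - g = (SQ - g) - (SP + SQ - J) + (SP - I) := by abel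
  rw [e]
  have := norm_add_le (SQ - g - (SP + SQ - J)) (SP - I)
  have := norm_sub_le (SQ - g) (SP + SQ - J)
  linarith

/-- By the equation, `R^X` is the drift integral, plus the rough integral minus its germ, plus the
second order term `λ' ζ⁽²⁾`. -/
theorem IsRDESolution.norm_remainder_le (hsol : IsRDESolution b lam Z γ x X) {M : ℝ}
    (hbc : Continuous b) (hb : ∀ z, ‖b z‖ ≤ M) (hγ : ContinuousOn γ (Set.Icc 0 T)) {s t : ℝ}
    (hs : 0 ≤ s) (hst : s ≤ t) (ht : t ≤ T) {B : ℝ}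
    (hB : ∀ P : Partition s t, ‖(∑ i ∈ Finset.range P.N,
        germ Z (comp lam X γ) (compDeriv lam X γ (comp lam X γ)) (P.u i) (P.u (i + 1))) -
      germ Z (comp lam X γ) (compDeriv lam X γ (comp lam X γ)) s t‖ ≤ B) :
    ‖remainder Z.path X (comp lam X γ) s t‖ ≤ M * (t - s) + B +
      ‖tensorApply (compDeriv lam X γ (comp lam X γ) s) (Z.enh s t)‖ := by
  obtain ⟨I, hI, hXs⟩ := hsol.equation s ⟨hs, hst.trans ht⟩
  obtain ⟨J, hJ, hXt⟩ := hsol.equation t ⟨hs.trans hst, ht⟩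
  have h1 := hI.norm_sub_sub_germ_le hs hst hJ hB
  have hcont : ContinuousOn (fun r => b (X r, γ r)) (Set.Icc 0 T) :=
    hbc.comp_continuousOn (hsol.controlled.path.continuousOn.prodMk hγ)
  have hint : ∀ u v, 0 ≤ u → u ≤ v → v ≤ T →
      IntervalIntegrable (fun r => b (X r, γ r)) MeasureTheory.volume u v :=
    fun u v hu huv hv => (hcont.mono (by
      rw [Set.uIcc_of_le huv]
      exact Set.Icc_subset_Icc hu hv)).intervalIntegrable
  have h2 := intervalIntegral.integral_add_adjacent_intervals (hint 0 s le_rfl hs (hst.trans ht))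
    (hint s t hs hst ht)
  have h3 : ‖∫ r in s..t, b (X r, γ r)‖ ≤ M * (t - s) := by
    have := intervalIntegral.norm_integral_le_of_norm_le_const (a := s) (b := t) (C := M)
      (f := fun r => b (X r, γ r)) fun r _ => hb _
    rwa [abs_of_nonneg (sub_nonneg.2 hst)] at this
  have e : remainder Z.path X (comp lam X γ) s t = (∫ r in s..t, b (X r, γ r)) +
      (J - I - germ Z (comp lam X γ) (compDeriv lam X γ (comp lam X γ)) s t) +
      tensorApply (compDeriv lam X γ (comp lam X γ) s) (Z.enh s t) := by
    simp only [remainder, germ]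
    rw [incr, hXs, hXt, ← h2]
    abel
  rw [e]
  exact (norm_add_le _ _).trans (add_le_add ((norm_add_le _ _).trans (add_le_add h3 h1)) le_rfl)

/-- The coefficient in the bound on the defect of additivity of the germ. -/
noncomputable def defectConst (M L : ℝ) : ℝ :=
  5 * M + 6 * M ^ 2 + 4 * M ^ 3 * L ^ 2 + 2 * M ^ 3 * L

theorem defectConst_nonneg {M L : ℝ} (hM : 0 ≤ M) (hL : 0 ≤ L) : 0 ≤ defectConst M L := by
  unfold defectConst
  positivity

/-- Here `y` stands for `w^{1/p}`, `H` for `h^{1/p}`, `N` for the remainder of `λ(X,γ)` and `r` for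
the increment of its derivative. The bounds `H ≤ 1` and `y ≤ 3` bring all terms to the common order
`y^3`, while one factor `H` is kept for the later absorption. -/
theorem defect_arith {M L H ρ G y N r : ℝ} (hM : 0 ≤ M) (hL : 0 ≤ L) (hH : 0 ≤ H) (hH1 : H ≤ 1)
    (hρ : 0 ≤ ρ) (hG : 0 ≤ G) (hy : 0 ≤ y) (hy3 : y ≤ 3)
    (hN : N ≤ M * (G * y ^ 2) + 4 * M * (M * (L * (H * y))) ^ 2 + 5 * M * (ρ * y ^ 2))
    (hr : r ≤ 2 * M ^ 2 * (M * (L * (H * y)) + ρ * y ^ 2 + G * y ^ 2)) :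
    N * (L * (H * y)) + L * r * (H ^ 2 * y ^ 2) ≤
      L * H * defectConst M L * (1 + ρ + G) * y ^ 3 := by
  have hHy : H * y ≤ y := by nlinarith
  have hN' : N ≤ (M * G + 4 * M ^ 3 * L ^ 2 + 5 * M * ρ) * y ^ 2 := by
    have : 4 * M * (M * (L * (H * y))) ^ 2 ≤ 4 * M * (M * (L * y)) ^ 2 := by gcongr
    linarith
  have hr' : r ≤ 2 * M ^ 2 * (M * L + 3 * ρ + 3 * G) * y := by
    have h1 : M * (L * (H * y)) ≤ M * (L * y) := by gcongr
    have h2 : y ^ 2 ≤ 3 * y := by nlinarith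
    have h3 : ρ * y ^ 2 ≤ ρ * (3 * y) := by gcongr
    have h4 : G * y ^ 2 ≤ G * (3 * y) := by gcongr
    calc r ≤ _ := hr
      _ ≤ 2 * M ^ 2 * (M * (L * y) + ρ * (3 * y) + G * (3 * y)) := by gcongr
      _ = _ := by ring
  have hH2 : H ^ 2 ≤ H := by nlinarith
  calc N * (L * (H * y)) + L * r * (H ^ 2 * y ^ 2)
      ≤ ((M * G + 4 * M ^ 3 * L ^ 2 + 5 * M * ρ) * y ^ 2) * (L * (H * y)) +
        L * (2 * M ^ 2 * (M * L + 3 * ρ + 3 * G) * y) * (H * y ^ 2) := by gcongr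
    _ = L * H * (M * G + 4 * M ^ 3 * L ^ 2 + 5 * M * ρ +
          2 * M ^ 2 * (M * L + 3 * ρ + 3 * G)) * y ^ 3 := by ring
    _ ≤ L * H * (defectConst M L * (1 + ρ + G)) * y ^ 3 := by
        gcongr
        unfold defectConst
        have : 0 ≤ 4 * M * G + (4 * M ^ 3 * L ^ 2 + 2 * M ^ 3 * L) * (ρ + G) +
          (5 * M + 6 * M ^ 2) := by positivity
        linarith
    _ = _ := by ring

/-- A solution whose data are dominated by a control on a short interval: the improved bound on
its remainder. -/
theorem IsRDESolution.norm_remainder_le_of_control (hsol : IsRDESolution b lam Z γ x X)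
    (hp : 2 ≤ p) (hp' : p < 3) {M L h : ℝ} (hbc : Continuous b) (hb : ∀ z, ‖b z‖ ≤ M)
    (hl : HasCbBound lam M) (hγ : ContinuousOn γ (Set.Icc 0 T)) (hL : 0 ≤ L) (hh : 0 < h)
    (hh1 : h ≤ 1)
    (hζ : ∀ s t, 0 ≤ s → s ≤ t → t ≤ T → ‖incr Z.path s t‖ ≤ L * (t - s) ^ (1 / p))
    (hζ2 : ∀ (A : Vec d →L[ℝ] Lin d m) (s t : ℝ), 0 ≤ s → s ≤ t → t ≤ T →
      ‖tensorApply A (Z.enh s t)‖ ≤ L * ‖A‖ * (t - s) ^ (2 / p))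
    {a c ρ G : ℝ} (ha : 0 ≤ a) (hc : c ≤ T) (hρ : 0 ≤ ρ) (hG : 0 ≤ G) (w : ℝ → ℝ → ℝ)
    (hw : ∀ r u v, a ≤ r → r ≤ u → u ≤ v → v ≤ c → w r u + w u v ≤ w r v)
    (hw0 : ∀ s t, a ≤ s → s ≤ t → t ≤ c → 0 ≤ w s t)
    (hw3 : ∀ s t, a ≤ s → s ≤ t → t ≤ c → w s t ≤ 3)
    (hwh : ∀ s t, a ≤ s → s ≤ t → t ≤ c → t - s ≤ h * w s t)
    (hwR : ∀ s t, a ≤ s → s ≤ t → t ≤ c →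
      ‖remainder Z.path X (comp lam X γ) s t‖ ≤ ρ * w s t ^ (2 / p))
    (hwγ : ∀ s t, a ≤ s → s ≤ t → t ≤ c → ‖incr γ s t‖ ≤ G * w s t ^ (2 / p))
    {s t : ℝ} (has : a ≤ s) (hst : s ≤ t) (htc : t ≤ c) :
    ‖remainder Z.path X (comp lam X γ) s t‖ ≤
      (3 * M + M ^ 2 * L + 3 * (sewingConst (3 / p) * L * defectConst M L * h ^ (1 / p)) *
        (1 + ρ + G)) * w s t ^ (2 / p) := by
  have hM := hl.nonneg
  have hp0 : 0 < p := by linarith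
  have hθ : 1 < 3 / p := (one_lt_div hp0).2 hp'
  set H := h ^ (1 / p) with hHdef
  have hH0 : 0 ≤ H := Real.rpow_nonneg hh.le _
  have hH1 : H ≤ 1 := Real.rpow_le_one hh.le hh1 (by positivity)
  have hpow : ∀ (j : ℕ) (z : ℝ), 0 ≤ z → z ^ ((j : ℝ) / p) = (z ^ (1 / p)) ^ j := by
    intro j z hz
    rw [← Real.rpow_natCast, ← Real.rpow_mul hz]
    congr 1
    ring
  have hpow2 : ∀ z : ℝ, 0 ≤ z → z ^ (2 / p) = (z ^ (1 / p)) ^ 2 := fun z hz => by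
    simpa using hpow 2 z hz
  have hpow3 : ∀ z : ℝ, 0 ≤ z → z ^ (3 / p) = (z ^ (1 / p)) ^ 3 := fun z hz => by
    simpa using hpow 3 z hz
  have hy0 : ∀ s t, a ≤ s → s ≤ t → t ≤ c → 0 ≤ w s t ^ (1 / p) := fun s t h1 h2 h3 =>
    Real.rpow_nonneg (hw0 s t h1 h2 h3) _
  have hpow_le3 : ∀ z e : ℝ, 0 ≤ z → z ≤ 3 → 0 ≤ e → e ≤ 1 → z ^ e ≤ 3 := by
    intro z e h0 h3 he he1
    calc z ^ e ≤ 3 ^ e := Real.rpow_le_rpow h0 h3 he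
      _ ≤ 3 ^ (1 : ℝ) := Real.rpow_le_rpow_of_exponent_le (by norm_num) he1
      _ = 3 := Real.rpow_one 3
  have hy3 : ∀ s t, a ≤ s → s ≤ t → t ≤ c → w s t ^ (1 / p) ≤ 3 := fun s t h1 h2 h3 =>
    hpow_le3 _ _ (hw0 s t h1 h2 h3) (hw3 s t h1 h2 h3) (by positivity)
      ((div_le_one hp0).2 (by linarith))
  have htime : ∀ s t, a ≤ s → s ≤ t → t ≤ c → (t - s) ^ (1 / p) ≤ H * w s t ^ (1 / p) := by
    intro s t h1 h2 h3
    rw [hHdef, ← Real.mul_rpow hh.le (hw0 s t h1 h2 h3)]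
    exact Real.rpow_le_rpow (sub_nonneg.2 h2) (hwh s t h1 h2 h3) (by positivity)
  have hζw : ∀ s t, a ≤ s → s ≤ t → t ≤ c →
      ‖incr Z.path s t‖ ≤ L * (H * w s t ^ (1 / p)) := fun s t h1 h2 h3 =>
    (hζ s t (ha.trans h1) h2 (h3.trans hc)).trans
      (mul_le_mul_of_nonneg_left (htime s t h1 h2 h3) hL)
  have hζ2w : ∀ (A : Vec d →L[ℝ] Lin d m) s t, a ≤ s → s ≤ t → t ≤ c →
      ‖tensorApply A (Z.enh s t)‖ ≤ L * ‖A‖ * (H ^ 2 * (w s t ^ (1 / p)) ^ 2) := by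
    intro A s t h1 h2 h3
    refine (hζ2 A s t (ha.trans h1) h2 (h3.trans hc)).trans
      (mul_le_mul_of_nonneg_left ?_ (by positivity))
    rw [hpow2 _ (sub_nonneg.2 h2), ← mul_pow]
    exact pow_le_pow_left₀ (Real.rpow_nonneg (sub_nonneg.2 h2) _) (htime s t h1 h2 h3) 2
  set K := L * H * defectConst M L * (1 + ρ + G) with hKdef
  have hQ := defectConst_nonneg hM hL
  have hK : 0 ≤ K := by positivity
  have hsew : ∀ P : Partition s t, _ := fun P => norm_partition_sum_sub_le (a := a) (b := c)
    (s := s) (t := t) (θ := 3 / p) (K := K) hθ hK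
    (germ Z (comp lam X γ) (compDeriv lam X γ (comp lam X γ))) w has htc
    (fun r hr => by
      simp [germ, incr, tensorApply, Z.enh_self (ha.trans hr.1) (hr.2.trans hc)])
    hw0 hw (fun r u v h1 h2 h3 h4 => by
      simp only [germ]
      rw [germ_sub_sub Z _ _ (ha.trans h1) h2 h3 (h4.trans hc), norm_neg]
      have h12 := h1.trans h2
      have h23 := h2.trans h3
      have h34 := h3.trans h4
      set y := w r v ^ (1 / p) with hy
      have hyr : w r u ^ (1 / p) ≤ y := Real.rpow_le_rpow (hw0 r u h1 h2 h34)
        (by linarith [hw r u v h1 h2 h3 h4, hw0 u v h12 h3 h4]) (by positivity)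
      have hyu : w u v ^ (1 / p) ≤ y := Real.rpow_le_rpow (hw0 u v h12 h3 h4)
        (by linarith [hw r u v h1 h2 h3 h4, hw0 r u h1 h2 h34]) (by positivity)
      have hyr0 := hy0 r u h1 h2 h34
      have hyu0 := hy0 u v h12 h3 h4
      have hyy := hy0 r v h1 h23 h4
      have bγ : ‖incr γ r u‖ ≤ G * y ^ 2 := (hwγ r u h1 h2 h34).trans (by
        rw [hpow2 _ (hw0 r u h1 h2 h34)]
        gcongr)
      have bR : ‖remainder Z.path X (comp lam X γ) r u‖ ≤ ρ * y ^ 2 :=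
        (hwR r u h1 h2 h34).trans (by
          rw [hpow2 _ (hw0 r u h1 h2 h34)]
          gcongr)
      have bζ : ‖incr Z.path r u‖ ≤ L * (H * y) := (hζw r u h1 h2 h34).trans (by gcongr)
      have bζ' : ‖incr Z.path u v‖ ≤ L * (H * y) := (hζw u v h12 h3 h4).trans (by gcongr)
      have bX : ‖incr X r u‖ ≤ M * (L * (H * y)) + ρ * y ^ 2 :=
        (norm_incr_le X γ Z.path hl r u).trans (by gcongr)
      have bN := norm_remainder_comp_le_linear (lam := lam) X γ Z.path hl hl r u
      have bN' : ‖remainder Z.path (comp lam X γ) (compDeriv lam X γ (comp lam X γ)) r u‖ ≤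
          M * (G * y ^ 2) + 4 * M * (M * (L * (H * y))) ^ 2 + 5 * M * (ρ * y ^ 2) :=
        bN.trans (by gcongr)
      have bD := norm_incr_compDeriv_le X γ hl hl r u
      have bD' : ‖incr (compDeriv lam X γ (comp lam X γ)) r u‖ ≤
          2 * M ^ 2 * (M * (L * (H * y)) + ρ * y ^ 2 + G * y ^ 2) := bD.trans (by gcongr)
      have main := defect_arith hM hL hH0 hH1 hρ hG hyy (hy3 r v h1 h23 h4) bN' bD'
      rw [hpow3 _ (hw0 r v h1 h23 h4)]
      refine (norm_add_le _ _).trans (le_trans (add_le_add ?_ ?_) main)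
      · exact (ContinuousLinearMap.le_opNorm _ _).trans
          (mul_le_mul_of_nonneg_left bζ' (norm_nonneg _))
      · exact (hζ2w _ u v h12 h3 h4).trans (by gcongr)) P
  have hwst := hw0 s t has hst htc
  have hy := hy0 s t has hst htc
  have h1 := hsol.norm_remainder_le hbc hb hγ (ha.trans has) hst (htc.trans hc) hsew
  have h2 := (hζ2w (compDeriv lam X γ (comp lam X γ) s) s t has hst htc)
  -- This term involves neither `ρ` nor `G`, so no smallness is needed and `H ^ 2 ≤ 1` suffices.
  have h3 : L * ‖compDeriv lam X γ (comp lam X γ) s‖ * (H ^ 2 * (w s t ^ (1 / p)) ^ 2) ≤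
      L * M ^ 2 * (1 * (w s t ^ (1 / p)) ^ 2) := by
    have := norm_compDeriv_le X γ hl hl s
    have : H ^ 2 ≤ 1 := pow_le_one₀ hH0 hH1
    gcongr
  -- Since `2 / p ≤ 1` and `w ≤ 3`, the control itself is at most `3 w^{2/p}`.
  have h4 : t - s ≤ 3 * (w s t ^ (1 / p)) ^ 2 := by
    refine (hwh s t has hst htc).trans ?_
    have e : w s t = w s t ^ (1 - 2 / p) * w s t ^ (2 / p) := by
      have h2p : 0 ≤ 1 - 2 / p := sub_nonneg.2 ((div_le_one hp0).2 hp)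
      rw [← Real.rpow_add_of_nonneg hwst h2p (by positivity), sub_add_cancel, Real.rpow_one]
    have h5 : w s t ^ (1 - 2 / p) ≤ 3 := hpow_le3 _ _ hwst (hw3 s t has hst htc)
      (sub_nonneg.2 ((div_le_one hp0).2 hp)) (by
        have : 0 ≤ 2 / p := by positivity
        linarith)
    calc h * w s t ≤ 1 * w s t := by gcongr
      _ = w s t ^ (1 - 2 / p) * w s t ^ (2 / p) := by rw [one_mul, ← e]
      _ ≤ 3 * w s t ^ (2 / p) := by gcongr
      _ = _ := by rw [hpow2 _ hwst]
  have h5 : (w s t ^ (1 / p)) ^ 3 ≤ 3 * (w s t ^ (1 / p)) ^ 2 := by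
    have := hy3 s t has hst htc
    rw [pow_succ, mul_comm]
    gcongr
  have hC := (sewingConst_pos hθ).le
  rw [hpow2 _ hwst]
  rw [hpow3 _ hwst] at h1
  set Y := (w s t ^ (1 / p)) ^ 2
  have h6 : sewingConst (3 / p) * K * (w s t ^ (1 / p)) ^ 3 ≤
      sewingConst (3 / p) * K * (3 * Y) := by gcongr
  have h7 : M * (t - s) ≤ M * (3 * Y) := by gcongr
  calc _ ≤ M * (3 * Y) + sewingConst (3 / p) * K * (3 * Y) + L * M ^ 2 * (1 * Y) := by linarith
    _ = _ := by
      rw [hKdef]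
      ring

end Solution

/-! ### Absorption on a short interval -/

/-- A two-parameter function of finite `q`-variation is dominated by a normalised control. -/
theorem exists_control {E : Type*} [NormedAddCommGroup E] {q a c ρ : ℝ} (hq : 0 < q)
    (hρ : 0 < ρ) (A : ℝ → ℝ → E) (hA : ∀ s, A s s = 0)
    (h : qnorm q a c (fun s t => ‖A s t‖ₑ) ≤ ENNReal.ofReal ρ) :
    ∃ v : ℝ → ℝ → ℝ,
      (∀ r s t, a ≤ r → r ≤ s → s ≤ t → t ≤ c → v r s + v s t ≤ v r t) ∧
      (∀ s t, 0 ≤ v s t) ∧ (∀ s t, a ≤ s → s ≤ t → t ≤ c → v s t ≤ 1) ∧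
      ∀ s t, a ≤ s → s ≤ t → t ≤ c → ‖A s t‖ ≤ ρ * v s t ^ (1 / q) := by
  set S := fun s t => supSum s t (fun u v => ‖A u v‖ₑ ^ q) with hS
  have hρq : 0 < ρ ^ q := Real.rpow_pos_of_pos hρ q
  have hac : S a c ≤ ENNReal.ofReal (ρ ^ q) := by
    have := h
    rwa [qnorm, one_div, ENNReal.rpow_inv_le_iff hq, ENNReal.ofReal_rpow_of_pos hρ] at this
  have hle : ∀ s t, a ≤ s → s ≤ t → t ≤ c → S s t ≤ ENNReal.ofReal (ρ ^ q) :=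
    fun s t h1 h2 h3 => (supSum_mono_interval h1 h2 h3 _).trans hac
  have hfin : ∀ s t, a ≤ s → s ≤ t → t ≤ c → S s t ≠ ∞ := fun s t h1 h2 h3 =>
    ((hle s t h1 h2 h3).trans_lt ENNReal.ofReal_lt_top).ne
  refine ⟨fun s t => (S s t).toReal / ρ ^ q, ?_, fun s t => by positivity, ?_, ?_⟩
  · intro r s t h1 h2 h3 h4
    have h5 := hfin r s h1 h2 (h3.trans h4)
    have h6 := hfin s t (h1.trans h2) h3 h4
    rw [← add_div, ← ENNReal.toReal_add h5 h6]
    exact div_le_div_of_nonneg_right (ENNReal.toReal_mono (hfin r t h1 (h2.trans h3) h4)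
      (supSum_add_le h2 h3 _)) hρq.le
  · intro s t h1 h2 h3
    rw [div_le_one hρq]
    exact ENNReal.toReal_le_of_le_ofReal hρq.le (hle s t h1 h2 h3)
  · intro s t h1 h2 h3
    rw [Real.div_rpow ENNReal.toReal_nonneg hρq.le, ← Real.rpow_mul hρ.le,
      mul_one_div_cancel hq.ne', Real.rpow_one, mul_div_cancel₀ _ hρ.ne']
    rcases h2.eq_or_lt with rfl | h2
    · rw [hA, norm_zero]
      positivity
    · have h4 : ‖A s t‖ₑ ^ q ≤ S s t := le_supSum h2 (fun u v => ‖A u v‖ₑ ^ q)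
      have h5 := ENNReal.toReal_mono (hfin s t h1 h2.le h3) h4
      rw [← ENNReal.toReal_rpow, toReal_enorm] at h5
      rw [one_div, Real.le_rpow_inv_iff_of_pos (norm_nonneg _) ENNReal.toReal_nonneg hq]
      exact h5

section Solution

variable {m k d : ℕ} {p T : ℝ} {b : Vec m × Vec k → Vec m} {lam : Vec m × Vec k → Lin d m}
  {Z : RoughPath d p T} {γ : ℝ → Vec k} {x : Vec m} {X : ℝ → Vec m}

/-- The remainder of a solution over a short interval. -/
theorem IsRDESolution.qnorm_remainder_le (hsol : IsRDESolution b lam Z γ x X)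
    (hp : 2 ≤ p) (hp' : p < 3) {M L h : ℝ} (hbc : Continuous b) (hb : ∀ z, ‖b z‖ ≤ M)
    (hl : HasCbBound lam M) (hγ : IsVarPath (p / 2) T γ) (hL : 0 ≤ L) (hh : 0 < h)
    (hh1 : h ≤ 1)
    (hsmall : 9 * (sewingConst (3 / p) * L * defectConst M L * h ^ (1 / p)) ≤ 1 / 2)
    (hζ : ∀ s t, 0 ≤ s → s ≤ t → t ≤ T → ‖incr Z.path s t‖ ≤ L * (t - s) ^ (1 / p))
    (hζ2 : ∀ (A : Vec d →L[ℝ] Lin d m) (s t : ℝ), 0 ≤ s → s ≤ t → t ≤ T →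
      ‖tensorApply A (Z.enh s t)‖ ≤ L * ‖A‖ * (t - s) ^ (2 / p))
    {a c : ℝ} (ha : 0 ≤ a) (hac : a ≤ c) (hc : c ≤ T) (hch : c - a ≤ h) :
    qnorm (p / 2) a c (fun s t => ‖remainder Z.path X (comp lam X γ) s t‖ₑ) ≤
      ENNReal.ofReal (18 * M + 6 * M ^ 2 * L + 3) + pVar (p / 2) T γ := by
  have hM := hl.nonneg
  have hp0 : 0 < p := by linarith
  have hq : 0 < p / 2 := by positivity
  set R := fun s t => remainder Z.path X (comp lam X γ) s t with hR
  set N := qnorm (p / 2) a c (fun s t => ‖R s t‖ₑ) with hN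
  -- A priori finiteness is what permits moving `N` to the left side at the end.
  have hNfin : N ≠ ∞ := by
    refine (lt_of_le_of_lt ?_ hsol.controlled.remainder_finite).ne
    exact ENNReal.rpow_le_rpow (supSum_mono_interval ha hac hc _) (by positivity)
  set g := (pVar (p / 2) T γ).toReal with hg
  have hg0 : 0 ≤ g := ENNReal.toReal_nonneg
  have hgγ : qnorm (p / 2) a c (fun s t => ‖incr γ s t‖ₑ) ≤ ENNReal.ofReal (g + 1) := by
    refine le_trans (ENNReal.rpow_le_rpow (supSum_mono_interval ha hac hc _) (by positivity)) ?_
    change pVar (p / 2) T γ ≤ _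
    exact ENNReal.le_ofReal_iff_toReal_le hγ.finite.ne (by positivity) |>.2 (by linarith)
  set r := N.toReal with hr
  have hr0 : 0 ≤ r := ENNReal.toReal_nonneg
  -- Normalising by `r + 1` and `g + 1` avoids division by zero; together with the `1` of the local
  -- estimate, these units produce the final summand `3`.
  obtain ⟨v₁, hs1, h01, hle1, hb1⟩ := exists_control hq (by positivity : 0 < r + 1) R
    (fun s => by simp [hR, remainder, incr])
    ((ENNReal.le_ofReal_iff_toReal_le hNfin (by positivity)).2 (by linarith))
  obtain ⟨v₂, hs2, h02, hle2, hb2⟩ := exists_control hq (by positivity : 0 < g + 1) (incr γ)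
    (fun s => by simp [incr]) hgγ
  rw [one_div_div] at hb1 hb2
  -- Each summand is at most `1` on `[a,c]`, so `w ≤ 3`. The time term gives `t - s ≤ h * w s t`,
  -- the source of the small factor `h^{1/p}`.
  set w : ℝ → ℝ → ℝ := fun s t => (t - s) / h + v₁ s t + v₂ s t with hw
  have hw1 : ∀ s t, s ≤ t → v₁ s t ≤ w s t := fun s t hst => by
    have := div_nonneg (sub_nonneg.2 hst) hh.le
    linarith [h02 s t]
  have hw2 : ∀ s t, s ≤ t → v₂ s t ≤ w s t := fun s t hst => by
    have := div_nonneg (sub_nonneg.2 hst) hh.le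
    linarith [h01 s t]
  have hwadd : ∀ r u v, a ≤ r → r ≤ u → u ≤ v → v ≤ c → w r u + w u v ≤ w r v := by
    intro r u v h1 h2 h3 h4
    have e : (v - r) / h = (u - r) / h + (v - u) / h := by ring
    linarith [hs1 r u v h1 h2 h3 h4, hs2 r u v h1 h2 h3 h4]
  have hw0 : ∀ s t, s ≤ t → 0 ≤ w s t := fun s t hst => (h01 s t).trans (hw1 s t hst)
  have hw3 : ∀ s t, a ≤ s → s ≤ t → t ≤ c → w s t ≤ 3 := by
    intro s t h1 h2 h3
    have : (t - s) / h ≤ 1 := (div_le_one hh).2 (by linarith)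
    linarith [hle1 s t h1 h2 h3, hle2 s t h1 h2 h3]
  set D := 3 * M + M ^ 2 * L + 3 * (sewingConst (3 / p) * L * defectConst M L * h ^ (1 / p)) *
    (1 + (r + 1) + (g + 1)) with hD
  have hC := (sewingConst_pos ((one_lt_div hp0).2 hp' : 1 < 3 / p)).le
  have hQ := defectConst_nonneg hM hL
  have hD0 : 0 ≤ D := by positivity
  have hpt : ∀ s t, a ≤ s → s < t → t ≤ c →
      ‖R s t‖ₑ ^ (p / 2) ≤ ENNReal.ofReal (D ^ (p / 2) * w s t) := by
    intro s t h1 h2 h3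
    have h4 := hsol.norm_remainder_le_of_control hp hp' hbc hb hl hγ.continuousOn hL hh hh1 hζ
      hζ2 (ρ := r + 1) (G := g + 1) ha hc (by positivity) (by positivity) w hwadd (fun s t _ h2 _ => hw0 s t h2) hw3
      (fun s t _ h2 _ => by
        rw [mul_comm, ← div_le_iff₀ hh]
        linarith [h01 s t, h02 s t])
      (fun s t h1 h2 h3 => (hb1 s t h1 h2 h3).trans (by
        have := hw1 s t h2
        have := h01 s t
        gcongr))
      (fun s t h1 h2 h3 => (hb2 s t h1 h2 h3).trans (by
        have := hw2 s t h2
        have := h02 s t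
        gcongr)) h1 h2.le h3
    have h5 := hw0 s t h2.le
    rw [← ofReal_norm, ENNReal.ofReal_rpow_of_nonneg (norm_nonneg _) hq.le]
    refine ENNReal.ofReal_le_ofReal ?_
    calc ‖R s t‖ ^ (p / 2) ≤ (D * w s t ^ (2 / p)) ^ (p / 2) :=
          Real.rpow_le_rpow (norm_nonneg _) h4 hq.le
      _ = D ^ (p / 2) * w s t := by
          rw [Real.mul_rpow hD0 (Real.rpow_nonneg h5 _), ← Real.rpow_mul h5]
          congr 1
          rw [show 2 / p * (p / 2) = 1 by field_simp, Real.rpow_one]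
  have hfinal := qnorm_le_of_superadditive hq hpt (fun r s t h1 h2 h3 h4 => by
    rw [← ENNReal.ofReal_add (mul_nonneg (by positivity) (hw0 r s h2))
      (mul_nonneg (by positivity) (hw0 s t h3)), ← mul_add]
    have := hwadd r s t h1 h2 h3 h4
    gcongr)
  have hwac := hw0 a c hac
  rw [ENNReal.ofReal_rpow_of_nonneg (by positivity) (by positivity)] at hfinal
  have hr3 : r ≤ 3 * D := by
    have h1 := ENNReal.toReal_le_of_le_ofReal (by positivity) hfinal
    refine h1.trans ?_
    rw [one_div_div, Real.mul_rpow (by positivity) hwac, ← Real.rpow_mul hD0,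
      show p / 2 * (2 / p) = 1 by field_simp, Real.rpow_one, mul_comm]
    gcongr
    have h2p : 2 / p ≤ 1 := (div_le_one hp0).2 hp
    calc w a c ^ (2 / p) ≤ 3 ^ (2 / p) :=
          Real.rpow_le_rpow hwac (hw3 a c le_rfl hac le_rfl) (by positivity)
      _ ≤ 3 ^ (1 : ℝ) := Real.rpow_le_rpow_of_exponent_le (by norm_num) h2p
      _ = 3 := Real.rpow_one 3
  -- From `r ≤ 3 D` and the smallness of `h`, `r ≤ 9 M + 3 M² L + (3 + r + g) / 2`; solve for `r`.
  have hr4 : r ≤ 18 * M + 6 * M ^ 2 * L + 3 + g := by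
    have : 9 * (sewingConst (3 / p) * L * defectConst M L * h ^ (1 / p)) *
        (1 + (r + 1) + (g + 1)) ≤ 1 / 2 * (1 + (r + 1) + (g + 1)) := by gcongr
    linarith
  calc N = ENNReal.ofReal r := (ENNReal.ofReal_toReal hNfin).symm
    _ ≤ ENNReal.ofReal (18 * M + 6 * M ^ 2 * L + 3 + g) := ENNReal.ofReal_le_ofReal hr4
    _ = _ := by
      rw [ENNReal.ofReal_add (by positivity) hg0, ENNReal.ofReal_toReal hγ.finite.ne]

end Solution

/-! ### Global bounds -/

theorem pVar2_eq_qnorm {E : Type*} [NormedAddCommGroup E] (q T : ℝ) (A : ℝ → ℝ → E) :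
    pVar2 q T A = qnorm q 0 T (fun s t => ‖A s t‖ₑ) := rfl

theorem pVar_eq_qnorm {E : Type*} [NormedAddCommGroup E] (q T : ℝ) (X : ℝ → E) :
    pVar q T X = qnorm q 0 T (fun s t => ‖incr X s t‖ₑ) := rfl

theorem le_one_add_rpow (g : ℝ≥0∞) {q : ℝ} (hq : 1 ≤ q) : g ≤ 1 + g ^ q := by
  rcases le_total g 1 with h | h
  · exact h.trans le_self_add
  · calc g = g ^ (1 : ℝ) := (ENNReal.rpow_one g).symm
      _ ≤ g ^ q := ENNReal.rpow_le_rpow_of_exponent_le h hq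
      _ ≤ 1 + g ^ q := le_add_self

theorem one_add_le_two_mul (g : ℝ≥0∞) {q : ℝ} (hq : 1 ≤ q) : 1 + g ≤ 2 * (1 + g ^ q) :=
  calc 1 + g ≤ 1 + (1 + g ^ q) := by
        gcongr
        exact le_one_add_rpow g hq
    _ ≤ (1 + g ^ q) + (1 + g ^ q) := by
        gcongr
        exact le_self_add
    _ = _ := (two_mul _).symm

/-- The witness is a `p`-th power, so that `h^{1/p} = 1 / (18 (c + 1))`. -/
theorem exists_small_step {p c : ℝ} (hp : 0 < p) (hc : 0 ≤ c) :
    ∃ h : ℝ, 0 < h ∧ h ≤ 1 ∧ 9 * (c * h ^ (1 / p)) ≤ 1 / 2 := by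
  have h0 : 0 < 1 / (18 * (c + 1)) := by positivity
  refine ⟨(1 / (18 * (c + 1))) ^ p, Real.rpow_pos_of_pos h0 p, Real.rpow_le_one h0.le ?_ hp.le, ?_⟩
  · rw [div_le_one (by positivity)]
    linarith
  · rw [← Real.rpow_mul h0.le, mul_one_div_cancel hp.ne', Real.rpow_one]
    rw [mul_one_div, mul_div_assoc', div_le_div_iff₀ (by positivity) (by norm_num)]
    linarith

section Solution

variable {m k d n : ℕ} {p T : ℝ} {b : Vec m × Vec k → Vec m} {lam : Vec m × Vec k → Lin d m}

theorem RoughPath.holder_path_le {L : ℝ} {Z : RoughPath d p T}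
    (hZ : Z.holderNorm ≤ ENNReal.ofReal L) (hL : 0 ≤ L) (hp : 0 < p) {s t : ℝ} (hs : 0 ≤ s)
    (hst : s ≤ t) (ht : t ≤ T) : ‖incr Z.path s t‖ ≤ L * (t - s) ^ (1 / p) := by
  rcases hst.eq_or_lt with rfl | hst
  · have : (0 : ℝ) < 1 / p := by positivity
    rw [sub_self, Real.zero_rpow this.ne']
    simp [incr]
  · exact norm_le_of_holder2_le hL (le_self_add.trans hZ) hs hst ht

theorem RoughPath.norm_tensorApply_enh_le {L : ℝ} {Z : RoughPath d p T}
    (hZ : Z.holderNorm ≤ ENNReal.ofReal L) (hL : 0 ≤ L)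
    (A : Vec d →L[ℝ] Lin d m) {s t : ℝ} (hs : 0 ≤ s)
    (hst : s ≤ t) (ht : t ≤ T) :
    ‖tensorApply A (Z.enh s t)‖ ≤ (d * d + 1) * L * ‖A‖ * (t - s) ^ (2 / p) := by
  have hts : 0 ≤ (t - s) ^ (2 / p) := Real.rpow_nonneg (sub_nonneg.2 hst) _
  rcases hst.eq_or_lt with rfl | hst
  · rw [Z.enh_self hs ht]
    simp only [tensorApply, map_zero, norm_zero]
    positivity
  · have h1 := norm_le_of_holder2_le hL (le_add_self.trans hZ) hs hst ht
    calc _ ≤ (d * d : ℝ) * ‖A‖ * ‖Z.enh s t‖ := norm_tensorApply_le A _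
      _ ≤ (d * d + 1 : ℝ) * ‖A‖ * (L * (t - s) ^ (2 / p)) := by
        gcongr
        linarith
      _ = _ := by ring

/-- A bound on the remainder of a solution which is linear in the variation of `γ`. -/
theorem exists_remainder_bound (hp : 2 ≤ p) (hp' : p < 3) (hb : IsLipB b) (hl : IsCb 2 lam)
    {L : ℝ} (hT : 0 < T) (hL : 0 < L) :
    ∃ C : ℝ≥0, ∀ (Z : RoughPath d p T) (γ : ℝ → Vec k) (x : Vec m) (X : ℝ → Vec m),
      Z.holderNorm ≤ ENNReal.ofReal L → IsVarPath (p / 2) T γ → IsRDESolution b lam Z γ x X →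
      pVar2 (p / 2) T (remainder Z.path X (comp lam X γ)) ≤ C * (1 + pVar (p / 2) T γ) := by
  obtain ⟨hbc, M₁, hM₁⟩ := hb.exists_bound
  obtain ⟨M₂, hM₂⟩ := hl.exists_hasCbBound
  set M := max M₁ M₂ with hMdef
  have hbM : ∀ z, ‖b z‖ ≤ M := fun z => (hM₁ z).trans (le_max_left _ _)
  have hlM : HasCbBound lam M := hM₂.mono (le_max_right _ _)
  have hM := hlM.nonneg
  have hp0 : 0 < p := by linarith
  -- One constant serves both levels of the rough path; the added `1` ensures `L ≤ L'` even for `d =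
  -- 0`.
  set L' : ℝ := (d * d + 1) * L with hL'
  have hL'0 : 0 ≤ L' := by positivity
  have hLL' : L ≤ L' := by
    have : (0 : ℝ) ≤ d * d * L := by positivity
    linarith
  have hC := (sewingConst_pos ((one_lt_div hp0).2 hp' : 1 < 3 / p)).le
  have hQ := defectConst_nonneg hM hL'0
  obtain ⟨h, hh, hh1, hsmall⟩ := exists_small_step hp0
    (by positivity : 0 ≤ sewingConst (3 / p) * L' * defectConst M L')
  -- The number of intervals depends on `h` and `T` only, neither on `γ` nor on `X`.
  set N := ⌈T / h⌉₊ + 1 with hN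
  have hN0 : (0 : ℝ) < N := by positivity
  have hTN : (N : ℝ) * (T / N) = T := mul_div_cancel₀ T hN0.ne'
  have hstep : T / N ≤ h := by
    rw [div_le_iff₀ hN0, mul_comm, ← div_le_iff₀ hh, hN]
    push_cast
    linarith [Nat.le_ceil (T / h)]
  set B : ℝ := 18 * M + 6 * M ^ 2 * L' + 3 with hB
  set K : ℝ := 2 * M * (L' * T ^ (1 / p)) with hK
  have hK0 : 0 ≤ K := by positivity
  refine ⟨N * (B.toNNReal + 1 + K.toNNReal), fun Z γ x X hZ hγ hsol => ?_⟩
  have hζ : ∀ s t, 0 ≤ s → s ≤ t → t ≤ T → ‖incr Z.path s t‖ ≤ L' * (t - s) ^ (1 / p) :=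
    fun s t h1 h2 h3 => (Z.holder_path_le hZ hL.le hp0 h1 h2 h3).trans
      (mul_le_mul_of_nonneg_right hLL' (Real.rpow_nonneg (sub_nonneg.2 h2) _))
  set R := remainder Z.path X (comp lam X γ) with hR
  have hsub : ∀ r s t, 0 ≤ r → r ≤ s → s ≤ t → t ≤ T →
      ‖R r t‖ₑ ≤ ‖R r s‖ₑ + ‖R s t‖ₑ + ENNReal.ofReal K := by
    intro r s t h1 h2 h3 h4
    -- The failure of additivity of `R^X` is an increment of `λ(X,γ)` applied to one of `ζ`, hence
    -- bounded by `2 M` times `L' T^{1/p}`: this is `K`.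
    have e : R r t = R r s + R s t + (comp lam X γ s - comp lam X γ r) (incr Z.path s t) := by
      simp only [hR, remainder, incr, sub_apply, map_sub]
      abel
    have hle : ‖(comp lam X γ s - comp lam X γ r) (incr Z.path s t)‖ ≤ K := by
      refine (ContinuousLinearMap.le_opNorm _ _).trans (mul_le_mul ?_ ?_ (norm_nonneg _)
        (by positivity))
      · refine (norm_sub_le _ _).trans ?_
        have := hlM.norm_le (X s, γ s)
        have := hlM.norm_le (X r, γ r)
        simp only [comp]
        linarith
      · refine (hζ s t (h1.trans h2) h3 h4).trans (mul_le_mul_of_nonneg_left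
          (Real.rpow_le_rpow (sub_nonneg.2 h3) ?_ (by positivity)) hL'0)
        linarith [h1.trans h2]
    rw [e]
    refine (enorm_add_le _ _).trans (add_le_add (enorm_add_le _ _) ?_)
    rw [← ofReal_norm]
    exact ENNReal.ofReal_le_ofReal hle
  have hfinal := qnorm_le_nat_mul (q := p / 2) (h := T / N) (f := fun s t => ‖R s t‖ₑ)
    (K := ENNReal.ofReal K) (B := ENNReal.ofReal B + pVar (p / 2) T γ) (by linarith)
    (by positivity) N (fun s => by simp [hR, remainder, incr])
    (fun r s t h1 h2 h3 h4 => hsub r s t h1 h2 h3 (h4.trans hTN.le))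
    (fun i hi => by
      have hi' : ((i + 1 : ℕ) : ℝ) ≤ N := by exact_mod_cast hi
      refine hsol.qnorm_remainder_le hp hp' hbc hbM hlM hγ hL'0 hh hh1 hsmall hζ
        (fun A s t h1 h2 h3 => Z.norm_tensorApply_enh_le hZ hL.le A h1 h2 h3)
        (by positivity) ?_ ?_ ?_
      · gcongr
        omega
      · exact (mul_le_mul_of_nonneg_right hi' (by positivity)).trans hTN.le
      · push_cast
        linarith)
  rw [hTN] at hfinal
  change pVar2 (p / 2) T R ≤ _ at hfinal
  refine hfinal.trans ?_
  push_cast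
  rw [mul_assoc]
  gcongr
  change ENNReal.ofReal B + pVar (p / 2) T γ + ENNReal.ofReal K ≤
    (ENNReal.ofReal B + 1 + ENNReal.ofReal K) * (1 + pVar (p / 2) T γ)
  calc _ = (ENNReal.ofReal B + ENNReal.ofReal K) + 1 * pVar (p / 2) T γ := by ring
    _ ≤ (ENNReal.ofReal B + 1 + ENNReal.ofReal K) +
        (ENNReal.ofReal B + 1 + ENNReal.ofReal K) * pVar (p / 2) T γ := by
      gcongr
      · exact le_self_add
      · exact le_add_self.trans le_self_add
    _ = _ := by ring

/-- A `1/p`-Hölder path has the additive control `L^p (t - s)`. -/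
theorem RoughPath.pVar_path_le {L : ℝ} {Z : RoughPath d p T}
    (hZ : Z.holderNorm ≤ ENNReal.ofReal L) (hL : 0 ≤ L) (hp : 0 < p) :
    pVar p T Z.path ≤ ENNReal.ofReal (L ^ p * T) ^ (1 / p) := by
  have h := qnorm_le_of_superadditive (q := p) (a := 0) (b := T)
    (f := fun s t => ‖incr Z.path s t‖ₑ)
    (g := fun s t => ENNReal.ofReal (L ^ p * (t - s))) hp (fun s t h1 h2 h3 => by
      have h4 := Real.rpow_le_rpow (norm_nonneg _) (Z.holder_path_le hZ hL hp h1 h2.le h3) hp.le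
      have h5 : 0 ≤ t - s := sub_nonneg.2 h2.le
      rw [Real.mul_rpow hL (Real.rpow_nonneg h5 _), ← Real.rpow_mul h5,
        one_div_mul_cancel hp.ne', Real.rpow_one] at h4
      rw [← ofReal_norm, ENNReal.ofReal_rpow_of_nonneg (norm_nonneg _) hp.le]
      exact ENNReal.ofReal_le_ofReal h4)
    (fun r s t _ h2 h3 _ => by
      have hLp : 0 ≤ L ^ p := Real.rpow_nonneg hL p
      rw [← ENNReal.ofReal_add (mul_nonneg hLp (sub_nonneg.2 h2))
        (mul_nonneg hLp (sub_nonneg.2 h3)), ← mul_add]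
      gcongr
      linarith)
  rwa [sub_zero] at h

/-- Minkowski applied to `X_{s,t} = λ ζ_{s,t} + R^X_{s,t}`; the `p`-variation of the remainder is
dominated by its `p/2`-variation. -/
theorem pVar_le_of_remainder (hp : 2 ≤ p) {M : ℝ} (hl : HasCbBound lam M) (ζ : ℝ → Vec d)
    (γ : ℝ → Vec k) (X : ℝ → Vec m) :
    pVar p T X ≤ ENNReal.ofReal M * pVar p T ζ +
      pVar2 (p / 2) T (remainder ζ X (comp lam X γ)) := by
  have hp0 : 0 < p := by linarith
  have h1 : pVar p T X ≤ qnorm p 0 T (fun s t => ENNReal.ofReal M * ‖incr ζ s t‖ₑ +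
      ‖remainder ζ X (comp lam X γ) s t‖ₑ) := by
    rw [pVar_eq_qnorm]
    refine qnorm_mono hp0 fun s t _ _ _ => ?_
    simp only [← ofReal_norm]
    rw [← ENNReal.ofReal_mul hl.nonneg, ← ENNReal.ofReal_add
      (mul_nonneg hl.nonneg (norm_nonneg _)) (norm_nonneg _)]
    exact ENNReal.ofReal_le_ofReal (norm_incr_le X γ ζ hl s t)
  refine h1.trans ((qnorm_add_le (by linarith) _ _).trans (add_le_add ?_ ?_))
  · exact qnorm_const_mul_le hp0 _ _
  · exact qnorm_antitone (by linarith) (by linarith) _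

theorem exists_solution_bound (hp : 2 ≤ p) (hp' : p < 3) (hb : IsLipB b) (hl : IsCb 2 lam)
    {L : ℝ} (hT : 0 < T) (hL : 0 < L) :
    ∃ C : ℝ≥0, ∀ (Z : RoughPath d p T) (γ : ℝ → Vec k) (x : Vec m) (X : ℝ → Vec m),
      Z.holderNorm ≤ ENNReal.ofReal L → IsVarPath (p / 2) T γ → IsRDESolution b lam Z γ x X →
      pVar p T X ≤ C * (1 + pVar (p / 2) T γ) := by
  obtain ⟨C, hC⟩ := exists_remainder_bound hp hp' hb hl hT hL
  obtain ⟨M, hM⟩ := hl.exists_hasCbBound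
  have hp0 : 0 < p := by linarith
  have hfin : ENNReal.ofReal (L ^ p * T) ^ (1 / p) ≠ ∞ :=
    ENNReal.rpow_ne_top_of_nonneg (by positivity) ENNReal.ofReal_ne_top
  refine ⟨M.toNNReal * (ENNReal.ofReal (L ^ p * T) ^ (1 / p)).toNNReal + C,
    fun Z γ x X hZ hγ hsol => ?_⟩
  push_cast
  rw [ENNReal.coe_toNNReal hfin, add_mul]
  refine (pVar_le_of_remainder hp hM Z.path γ X).trans (add_le_add ?_ (hC Z γ x X hZ hγ hsol))
  refine le_trans (mul_le_mul_right (Z.pVar_path_le hZ hL.le hp0) _) ?_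
  exact le_mul_of_one_le_right zero_le le_self_add

theorem pVar_compDeriv_le (hp : 2 ≤ p) {ψ : Vec m × Vec k → Lin d n} {M : ℝ}
    (hψ : HasCbBound ψ M) (hl : HasCbBound lam M) (γ : ℝ → Vec k) (X : ℝ → Vec m) :
    pVar p T (compDeriv ψ X γ (comp lam X γ)) ≤
      ENNReal.ofReal (2 * M ^ 2) * (pVar p T X + pVar (p / 2) T γ) := by
  have hp0 : 0 < p := by linarith
  have h1 : pVar p T (compDeriv ψ X γ (comp lam X γ)) ≤ qnorm p 0 T (fun s t =>
      ENNReal.ofReal (2 * M ^ 2) * (‖incr X s t‖ₑ + ‖incr γ s t‖ₑ)) := by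
    rw [pVar_eq_qnorm]
    refine qnorm_mono hp0 fun s t _ _ _ => ?_
    simp only [← ofReal_norm]
    rw [← ENNReal.ofReal_add (norm_nonneg _) (norm_nonneg _),
      ← ENNReal.ofReal_mul (by positivity)]
    exact ENNReal.ofReal_le_ofReal (norm_incr_compDeriv_le X γ hψ hl s t)
  refine h1.trans ((qnorm_const_mul_le hp0 _ _).trans (mul_le_mul_right ?_ _))
  refine (qnorm_add_le (by linarith) _ _).trans (add_le_add le_rfl ?_)
  exact qnorm_antitone (by linarith) (by linarith) _

theorem pVar2_remainder_comp_le (hp : 2 ≤ p) {ψ : Vec m × Vec k → Lin d n} {M : ℝ}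
    (hψ : HasCbBound ψ M) (lam : Vec m × Vec k → Lin d m) (ζ : ℝ → Vec d) (γ : ℝ → Vec k)
    (X : ℝ → Vec m) :
    pVar2 (p / 2) T (remainder ζ (comp ψ X γ) (compDeriv ψ X γ (comp lam X γ))) ≤
      ENNReal.ofReal M * (pVar p T X ^ 2 + pVar2 (p / 2) T (remainder ζ X (comp lam X γ)) +
        pVar (p / 2) T γ) := by
  have hp0 : 0 < p / 2 := by linarith
  have h1 : pVar2 (p / 2) T (remainder ζ (comp ψ X γ) (compDeriv ψ X γ (comp lam X γ))) ≤
      qnorm (p / 2) 0 T (fun s t => ENNReal.ofReal M * (‖incr X s t‖ₑ ^ 2 +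
        ‖remainder ζ X (comp lam X γ) s t‖ₑ + ‖incr γ s t‖ₑ)) := by
    rw [pVar2_eq_qnorm]
    refine qnorm_mono hp0 fun s t _ _ _ => ?_
    simp only [← ofReal_norm]
    rw [← ENNReal.ofReal_pow (norm_nonneg _), ← ENNReal.ofReal_add (by positivity)
      (norm_nonneg _), ← ENNReal.ofReal_add (by positivity) (norm_nonneg _),
      ← ENNReal.ofReal_mul hψ.nonneg]
    exact ENNReal.ofReal_le_ofReal (norm_remainder_comp_le X γ ζ hψ s t)
  refine h1.trans ((qnorm_const_mul_le hp0 _ _).trans (mul_le_mul_right ?_ _))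
  refine (qnorm_add_le (by linarith) _ _).trans (add_le_add ?_ le_rfl)
  refine (qnorm_add_le (by linarith) _ _).trans (add_le_add (le_of_eq ?_) le_rfl)
  exact qnorm_half_sq _

end Solution

end RoughControl

open RoughControl in
theorem mainTheorem6 (m k d n : ℕ) (p : ℝ) (hp : 2 ≤ p) (hp' : p < 3) :
    -- the Gubinelli derivative of the composition
    (∀ (lam : Vec m × Vec k → Lin d m) (ψ : Vec m × Vec k → Lin d n), IsCb 2 lam → IsCb 2 ψ →
      ∃ C : ℝ≥0, ∀ (b : Vec m × Vec k → Vec m), IsLipB b →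
        ∀ (T : ℝ), 0 < T → ∀ (Z : RoughPath d p T) (γ : ℝ → Vec k) (x : Vec m) (X : ℝ → Vec m),
          IsVarPath (p / 2) T γ → IsRDESolution b lam Z γ x X →
          pVar p T (compDeriv ψ X γ (comp lam X γ)) ≤ C * (pVar p T X + pVar (p / 2) T γ)) ∧
    -- the remainder of the composition
    (∀ (ψ : Vec m × Vec k → Lin d n), IsCb 2 ψ →
      ∃ C : ℝ≥0, ∀ (b : Vec m × Vec k → Vec m) (lam : Vec m × Vec k → Lin d m),
        IsLipB b → IsCb 2 lam →
        ∀ (T : ℝ), 0 < T → ∀ (Z : RoughPath d p T) (γ : ℝ → Vec k) (x : Vec m) (X : ℝ → Vec m),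
          IsVarPath (p / 2) T γ → IsRDESolution b lam Z γ x X →
          pVar2 (p / 2) T (remainder Z.path (comp ψ X γ) (compDeriv ψ X γ (comp lam X γ))) ≤
            C * (pVar p T X ^ 2 + pVar2 (p / 2) T (remainder Z.path X (comp lam X γ)) +
              pVar (p / 2) T γ)) ∧
    -- the solution
    (∀ (b : Vec m × Vec k → Vec m) (lam : Vec m × Vec k → Lin d m), IsLipB b → IsCb 2 lam →
      ∀ (T L : ℝ), 0 < T → 0 < L →
      ∃ C : ℝ≥0, ∀ (Z : RoughPath d p T) (γ : ℝ → Vec k) (x : Vec m) (X : ℝ → Vec m),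
        Z.holderNorm ≤ ENNReal.ofReal L →
        IsVarPath (p / 2) T γ → IsRDESolution b lam Z γ x X →
        pVar p T X ≤ C * (1 + pVar (p / 2) T γ ^ (1 + p))) ∧
    -- the remainder of the solution
    (∀ (b : Vec m × Vec k → Vec m) (lam : Vec m × Vec k → Lin d m), IsLipB b → IsCb 2 lam →
      ∀ (T L : ℝ), 0 < T → 0 < L →
      ∃ C : ℝ≥0, ∀ (Z : RoughPath d p T) (γ : ℝ → Vec k) (x : Vec m) (X : ℝ → Vec m),
        Z.holderNorm ≤ ENNReal.ofReal L →
        IsVarPath (p / 2) T γ → IsRDESolution b lam Z γ x X →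
        pVar2 (p / 2) T (remainder Z.path X (comp lam X γ)) ≤
          C * (1 + pVar (p / 2) T γ ^ (2 + p))) := by
  refine ⟨fun lam ψ hl hψ => ?_, fun ψ hψ => ?_, fun b lam hb hl T L hT hL => ?_,
    fun b lam hb hl T L hT hL => ?_⟩
  · obtain ⟨M₁, hM₁⟩ := hl.exists_hasCbBound
    obtain ⟨M₂, hM₂⟩ := hψ.exists_hasCbBound
    exact ⟨(2 * max M₁ M₂ ^ 2).toNNReal, fun b _ T _ Z γ x X _ _ =>
      pVar_compDeriv_le hp (hM₂.mono (le_max_right _ _)) (hM₁.mono (le_max_left _ _)) γ X⟩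
  · obtain ⟨M, hM⟩ := hψ.exists_hasCbBound
    exact ⟨M.toNNReal, fun b lam _ _ T _ Z γ x X _ _ =>
      pVar2_remainder_comp_le hp hM lam Z.path γ X⟩
  · obtain ⟨C, hC⟩ := exists_solution_bound hp hp' hb hl hT hL
    -- The linear bound is stronger; the factor `2` pays for replacing `1 + g` by `1 + g^{1+p}`.
    refine ⟨C * 2, fun Z γ x X hZ hγ hsol => (hC Z γ x X hZ hγ hsol).trans ?_⟩
    push_cast
    rw [mul_assoc]
    gcongr
    exact one_add_le_two_mul _ (by linarith)
  · obtain ⟨C, hC⟩ := exists_remainder_bound hp hp' hb hl hT hL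
    refine ⟨C * 2, fun Z γ x X hZ hγ hsol => (hC Z γ x X hZ hγ hsol).trans ?_⟩
    push_cast
    rw [mul_assoc]
    gcongr
    exact one_add_le_two_mul _ (by linarith)
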